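/- **Setting.** Let $\mathcal H$ be a separable complex Hilbert space, $H$ a self-adjoint (possibly unbounded) operator in $\mathcal H$, and $V$ a symmetric operator which is relatively $H$-bounded, i.e. $\operatorname{dom}H\subseteq\operatorname{dom}V$ and there are $a,b\ge 0$ with $\|V\psi\|\le a\|H\psi\|+b\|\psi\|$ for all $\psi\in\operatorname{dom}H$. Assume that the $H$-bound $a_0$ of $V$ (the infimum of all such $a$) satisfies $a_0<1$. Put $u(x)=x-i$. Let $W_0(\mathbb R)$ be the set of $g\in C_0(\mathbb R)$ of the form $g(x)=\int_{\mathbb R}e^{ixy}\,d\mu(y)$ with a finite complex Borel measure $\mu$, and write $\|\hat g\|_1$ for the total variation $|\mu|(\mathbb R)$ of this measure. For $n\ge0$ let $\mathscr W_n(\mathbb R)=\{f\in C^n(\mathbb R): (fu^p)^{(p)}\in W_0(\mathbb R),\ p=0,\dots,n\}$. Let $f\in\bigcap_{n\ge1}\mathscr W_n(\mathbb R)$, and let $c_f,C_f\ge0$ be constants. **Theorem.** For $t\in\mathbb R$ with $|t|a_0<1$ the operator $H+tV$ is self-adjoint, and $t\mapsto f(H+tV)$ is infinitely differentiable at $t=0$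 in operator norm. Moreover: 1. If $\|\widehat{(fu^n)^{(n)}}\|_1\le c_fC_f^n\,n!$ for all $n\ge1$ and $(1+C_f)\|V(H-i)^{-1}\|<1$, then $$f(H+V)=\sum_{n=0}^\infty\frac1{n!}\frac{d^n}{dt^n}f(H+tV)\Big|_{t=0},$$ and the series converges absolutely in operator norm. 2. If $\|\widehat{(fu^n)^{(n)}}\|_1\le c_fC_f^n\,n!$ for all $n\ge0$, then for all $n\ge0$ $$\Big\|f(H+V)-\sum_{k=0}^{n-1}\frac1{k!}\frac{d^k}{dt^k}f(H+tV)\Big|_{t=0}\Big\|\le c_f\big((1+C_f)\|V(H-i)^{-1}\|\big)^n.$$ 3. If $\|\widehat{(fu^n)^{(n)}}\|_1\le c_fC_f^n\,(n!)^\gamma$ for all $n\ge1$ and some real $\gamma<1$, and if $\|V(H-i)^{-1}\|<1$, then the conclusion of part 1 holds, whatever the size of $C_f$. -/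

import Mathlib

open Filter Topology MeasureTheory
open scoped ENNReal ContDiff

noncomputable section

namespace RelTaylor

/-! ### Function spaces -/

/-- The function `u(x) = x - i`. -/
def u (x : ℝ) : ℂ := (x : ℂ) - Complex.I

/-- `g(x) = ∫ e^{ixy} dμ(y)` for all real `x`, for a (finite) complex measure `μ`. -/
def IsFourierOf (g : ℝ → ℂ) (μ : ComplexMeasure ℝ) : Prop :=
  ∀ x : ℝ, g x = μ.integral (fun y : ℝ => Complex.exp (Complex.I * x * y))
    (ContinuousLinearMap.mul ℝ ℂ)

/-- `W₀(ℝ)`: functions in `C₀(ℝ)` that are Fourier transforms of finite complex measures. -/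
def W₀ : Set (ℝ → ℂ) :=
  {g | Continuous g ∧ Tendsto g (cocompact ℝ) (𝓝 0) ∧ ∃ μ : ComplexMeasure ℝ, IsFourierOf g μ}

/-- The function `(f uⁿ)⁽ⁿ⁾`. -/
def weightedDeriv (f : ℝ → ℂ) (n : ℕ) : ℝ → ℂ :=
  iteratedDeriv n (fun x => f x * u x ^ n)

/-- `𝒲ₙ(ℝ)`: the `f ∈ Cⁿ(ℝ)` with `(f uᵖ)⁽ᵖ⁾ ∈ W₀(ℝ)` for `p = 0, …, n`. -/
def W (n : ℕ) : Set (ℝ → ℂ) :=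
  {f | ContDiff ℝ n f ∧ ∀ p ≤ n, weightedDeriv f p ∈ W₀}

/-! ### Unbounded operators -/

variable {E : Type*} [NormedAddCommGroup E] [InnerProductSpace ℂ E] [CompleteSpace E]

/-- `a, b ≥ 0` are constants of relative boundedness: `dom H ⊆ dom V` and
`‖Vψ‖ ≤ a ‖Hψ‖ + b ‖ψ‖` on `dom H`. -/
def RelBoundedWith (H V : E →ₗ.[ℂ] E) (a b : ℝ) : Prop :=
  0 ≤ a ∧ 0 ≤ b ∧ ∀ ψ : H.domain, ∃ hψ : (ψ : E) ∈ V.domain,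
    ‖V ⟨ψ, hψ⟩‖ ≤ a * ‖H ψ‖ + b * ‖(ψ : E)‖

/-- `V` is relatively `H`-bounded. -/
def RelBounded (H V : E →ₗ.[ℂ] E) : Prop :=
  ∃ a b : ℝ, RelBoundedWith H V a b

/-- The `H`-bound of `V`. -/
def relBound (H V : E →ₗ.[ℂ] E) : ℝ :=
  sInf {a | ∃ b, RelBoundedWith H V a b}

/-- `R` is a bounded two-sided inverse of `A - z : dom A → E`. -/
def IsResolvent (A : E →ₗ.[ℂ] E) (z : ℂ) (R : E →L[ℂ] E) : Prop :=
  (∀ x : E, ∃ hx : R x ∈ A.domain, A ⟨R x, hx⟩ - z • R x = x) ∧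
    ∀ x : A.domain, R (A x - z • (x : E)) = x

open Classical in
/-- The bounded operator `(A - z)⁻¹` (it is unique when it exists; `0` otherwise). -/
def resolventOp (A : E →ₗ.[ℂ] E) (z : ℂ) : E →L[ℂ] E :=
  if h : ∃ R, IsResolvent A z R then h.choose else 0

open Classical in
/-- The bounded operator `V (H - i)⁻¹` (unique when it exists, as it does for `H` self-adjoint
and `V` relatively `H`-bounded; `0` otherwise). -/
def relOp (H V : E →ₗ.[ℂ] E) : E →L[ℂ] E :=
  if h : ∃ T : E →L[ℂ] E, ∀ x : E, ∃ hx : resolventOp H Complex.I x ∈ V.domain,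
      T x = V ⟨resolventOp H Complex.I x, hx⟩ then h.choose else 0

/-- The functional calculus `f(A)` of a self-adjoint operator `A` for `f ∈ C₀(ℝ)`, obtained from the
continuous functional calculus of the bounded normal operator `R = (A - i)⁻¹`: the spectrum of `R`
consists of the points `w = (λ - i)⁻¹`, `λ ∈ σ(A)`, and of `0` if `A` is unbounded; there
`λ = Re w⁻¹`, and the function `λ ↦ f(λ)` of `w` extends continuously by `0` to `w = 0`. -/
def funcCalc (f : ℝ → ℂ) (A : E →ₗ.[ℂ] E) : E →L[ℂ] E :=
  cfc (fun w : ℂ => if w = 0 then 0 else f (w⁻¹).re) (resolventOp A Complex.I)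

/-- The operator `H + tV`, with domain `dom H ∩ dom V`. -/
def pert (H V : E →ₗ.[ℂ] E) (t : ℝ) : E →ₗ.[ℂ] E := H + (t : ℂ) • V

/-- The `n`-th Taylor term `(1/n!) dⁿ/dtⁿ f(H + tV)|_{t=0}`, the derivatives being
taken in operator norm. -/
def taylorTerm (f : ℝ → ℂ) (H V : E →ₗ.[ℂ] E) (n : ℕ) : E →L[ℂ] E :=
  ((n.factorial : ℝ)⁻¹) • iteratedDeriv n (fun t : ℝ => funcCalc f (pert H V t)) 0

end RelTaylor

end

noncomputable section

namespace RelTaylor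

/-! ### Complex measures and their Fourier transforms -/

/-! Formally, `f(A + sV)` has Taylor coefficients given by multiple operator integrals with symbol
the divided difference `f^{[n]}(λ₀, …, λₙ)` and `n` factors `V`. Since `V` is unbounded, one writes
`V = K (A - i)` with `K = V (A - i)⁻¹` and moves the factors `u(λ₁) ⋯ u(λₙ)` into the symbol. By the
Leibniz rule for divided differences the new symbol is the alternating sum, over sublists `J` of
`(λ₁, …, λₙ)`, of `(f u^p)^{[p]}(λ₀, J)` with `p = |J|`. Each such term is an average of `(f
u^p)^{(p)}` over a simplex of mass `1/p!`, hence a superposition of products of exponentials with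
total mass at most `|μ_p|/p!`. Exponentials of self-adjoint operators are contractions, so with
`|μ_p|/p! ≤ b_p` the `n`-th coefficient has norm at most `‖K‖ⁿ ∑ₚ (n choose p) b_p`; for `b_p = c
C^p` this is `c ((1 + C) ‖K‖)ⁿ` (`norm_taylorOp_le`, `beta_le`).

The recursion of divided differences yields an exact remainder: the `n`-th coefficient with the
leftmost spectral resolution taken from `A + sV` (`taylorOp_expansion`). It obeys the same bound,
with no smallness condition on `s`.

Multiple operator integrals are avoided by proving this for finite spectral resolutions and passing
to the limit. Spectral cutoffs produce finite-dimensional models with nearly the same relative bound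
(`exists_finModel`). Their functional calculi converge (`tendsto_fc`), their coefficients converge
weakly along an ultrafilter, and norm bounds survive weak limits (`exists_taylor`).

Applying the expansion at every `H + tV` with small `t`, with uniform bounds, gives smoothness by
the converse of Taylor's theorem and identifies coefficients with derivatives
(`contDiffAt_of_taylor`). The expansion at `0`, evaluated at `s = 1`, gives the series and the
remainder bound. Self-adjointness is Kato–Rellich. -/

instance isFiniteMeasure_variation {α : Type*} [MeasurableSpace α] (μ : ComplexMeasure α) :
    IsFiniteMeasure μ.variation := by
  refine isFiniteMeasure_of_le
    (SignedMeasure.totalVariation (ComplexMeasure.re μ)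
      + SignedMeasure.totalVariation (ComplexMeasure.im μ)) ?_
  refine VectorMeasure.variation_le_of_forall_enorm_le fun s _ => ?_
  have h1 := SignedMeasure.enorm_le_totalVariation (ComplexMeasure.re μ) s
  have h2 := SignedMeasure.enorm_le_totalVariation (ComplexMeasure.im μ) s
  refine le_trans ?_ (add_le_add h1 h2)
  have : μ s = (((ComplexMeasure.re μ s : ℝ) : ℂ)) + (ComplexMeasure.im μ s : ℝ) * Complex.I :=
    (Complex.re_add_im (μ s)).symm
  rw [this]
  refine (enorm_add_le _ _).trans ?_
  rw [enorm_mul]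
  simp [enorm_eq_nnnorm]

/-- The pairing is only real-bilinear, so complex homogeneity needs its own argument. -/
lemma integral_const_mul (μ : ComplexMeasure ℝ) (c : ℂ) (φ : ℝ → ℂ) :
    μ.integral (fun y => c * φ y) (ContinuousLinearMap.mul ℝ ℂ)
      = c * μ.integral φ (ContinuousLinearMap.mul ℝ ℂ) := by
  rw [VectorMeasure.integral_eq_setToFun, VectorMeasure.integral_eq_setToFun]
  refine setToFun_smul (𝕜 := ℂ) _ (fun c s x => ?_) c φ
  change cbmApplyMeasure μ (ContinuousLinearMap.mul ℝ ℂ) s (c • x)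
    = c • cbmApplyMeasure μ (ContinuousLinearMap.mul ℝ ℂ) s x
  simp [mul_assoc]

/-- A finite combination of exponentials that is bounded by `M` turns, after integration against a
complex measure, into a vector of norm at most `M` times the total variation. -/
lemma norm_sum_fourier_smul_le {Y : Type*} [NormedAddCommGroup Y] [NormedSpace ℂ Y]
    {g : ℝ → ℂ} {ν : ComplexMeasure ℝ} (hν : IsFourierOf g ν) {κ : Type*} [Fintype κ]
    (L : κ → Y) (x : κ → ℝ) (M : ℝ)
    (hM : ∀ y : ℝ, ‖∑ k, Complex.exp (Complex.I * (y * x k : ℝ)) • L k‖ ≤ M) :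
    ‖∑ k, g (x k) • L k‖ ≤ M * ν.variation.real Set.univ := by
  -- A norming functional reduces the estimate to a scalar integral against `ν`.
  obtain ⟨φ, hφ, hφ'⟩ := exists_dual_vector'' ℂ (∑ k, g (x k) • L k)
  have hint : ∀ k, ν.Integrable (fun y : ℝ => φ (L k) * Complex.exp (Complex.I * x k * y)) := by
    intro k
    refine Integrable.const_mul ?_ _
    refine (integrable_const (1 : ℝ)).mono' (by fun_prop) (Eventually.of_forall fun y => ?_)
    rw [show Complex.I * x k * y = ((x k * y : ℝ) : ℂ) * Complex.I by push_cast; ring,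
      Complex.norm_exp_ofReal_mul_I]
  have h1 : φ (∑ k, g (x k) • L k)
      = ν.integral (fun y : ℝ => ∑ k, φ (L k) * Complex.exp (Complex.I * x k * y))
        (ContinuousLinearMap.mul ℝ ℂ) := by
    rw [VectorMeasure.integral_finsetSum _ fun k _ => hint k, map_sum]
    refine Finset.sum_congr rfl fun k _ => ?_
    rw [integral_const_mul, ← hν (x k), map_smul, smul_eq_mul, mul_comm]
  have h2 : ‖φ (∑ k, g (x k) • L k)‖ ≤ M * 1 * ν.variation.real Set.univ := by
    rw [h1]
    refine (VectorMeasure.norm_integral_le_of_norm_le_const (C := M)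
      (Eventually.of_forall fun y => ?_)).trans ?_
    · have : ∑ k, φ (L k) * Complex.exp (Complex.I * x k * y)
          = φ (∑ k, Complex.exp (Complex.I * (y * x k : ℝ)) • L k) := by
        rw [map_sum]
        refine Finset.sum_congr rfl fun k _ => ?_
        rw [map_smul, smul_eq_mul, mul_comm]
        push_cast
        ring_nf
      rw [this]
      exact (φ.le_of_opNorm_le hφ _).trans (by rw [one_mul]; exact hM y)
    · have hM0 : 0 ≤ M := (norm_nonneg _).trans (hM 0)
      gcongr
      exact ContinuousLinearMap.opNorm_mul_le ℝ ℂ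
  rw [hφ'] at h2
  simpa using h2

/-! ### Divided differences -/

/-- A sequence of functions each of which is the derivative of the previous one. -/
lemma iteratedDeriv_of_hasDerivAt_succ {Y : Type*} [NormedAddCommGroup Y] [NormedSpace ℝ Y]
    {b : ℕ → ℝ → Y} (hb : ∀ k x, HasDerivAt (b k) (b (k + 1) x) x) (k : ℕ) :
    iteratedDeriv k (b 0) = b k := by
  induction k with
  | zero => simp
  | succ k ih => rw [iteratedDeriv_succ, ih]; exact funext fun x => (hb k x).deriv

lemma contDiff_of_hasDerivAt_succ {Y : Type*} [NormedAddCommGroup Y] [NormedSpace ℝ Y]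
    {b : ℕ → ℝ → Y} (hb : ∀ k x, HasDerivAt (b k) (b (k + 1) x) x) :
    ContDiff ℝ ∞ (b 0) := by
  refine contDiff_of_differentiable_iteratedDeriv fun k _ => ?_
  rw [iteratedDeriv_of_hasDerivAt_succ hb]
  exact fun x => (hb k x).differentiableAt

lemma hasDerivAt_iteratedDeriv {h : ℝ → ℂ} (hh : ContDiff ℝ ∞ h) (k : ℕ) (x : ℝ) :
    HasDerivAt (iteratedDeriv k h) (iteratedDeriv (k + 1) h x) x := by
  rw [iteratedDeriv_succ]
  have : Differentiable ℝ (iteratedDeriv k h) :=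
    hh.differentiable_iteratedDeriv k (by exact_mod_cast WithTop.coe_lt_top (k : ℕ))
  exact (this x).hasDerivAt

/-- The first divided difference `x ↦ (h x - h z) / (x - z)`. -/
def dd (h : ℝ → ℂ) (z x : ℝ) : ℂ := ∫ θ in (0 : ℝ)..1, deriv h (z + θ * (x - z))

/-- Each differentiation in `x` brings out one more factor `θ`, so these integrals form a chain of
successive derivatives starting at `dd h z`. -/
lemma hasDerivAt_integral_pow_mul {h : ℝ → ℂ} (hh : ContDiff ℝ ∞ h) (z : ℝ) (k : ℕ) (x : ℝ) :
    HasDerivAt (fun x => ∫ θ in (0 : ℝ)..1, (θ : ℂ) ^ k * iteratedDeriv (k + 1) h (z + θ * (x - z)))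
      (∫ θ in (0 : ℝ)..1, (θ : ℂ) ^ (k + 1) * iteratedDeriv (k + 2) h (z + θ * (x - z))) x := by
  have hc : ∀ m : ℕ, Continuous (iteratedDeriv m h) := fun m =>
    hh.continuous_iteratedDeriv m (by exact_mod_cast le_top)
  have hcc : ∀ m n : ℕ, ∀ x : ℝ,
      Continuous fun θ : ℝ => (θ : ℂ) ^ n * iteratedDeriv m h (z + θ * (x - z)) := fun m n x =>
    (Complex.continuous_ofReal.pow n).mul ((hc m).comp (by fun_prop))
  -- For `|x' - x| < 1` and `θ ∈ (0, 1]` the point `z + θ (x' - z)` stays in `[-r, r]`, where the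
  -- next derivative is bounded by compactness.
  set r := |z| + (|x| + 1 + |z|) with hr
  obtain ⟨C, hC⟩ := (isCompact_Icc (a := -r) (b := r)).exists_bound_of_continuousOn
    (hc (k + 2)).continuousOn
  refine (intervalIntegral.hasDerivAt_integral_of_dominated_loc_of_deriv_le
    (F := fun x θ => (θ : ℂ) ^ k * iteratedDeriv (k + 1) h (z + θ * (x - z)))
    (F' := fun x θ => (θ : ℂ) ^ (k + 1) * iteratedDeriv (k + 2) h (z + θ * (x - z)))
    (bound := fun _ => C) (Metric.ball_mem_nhds x one_pos)
    (Eventually.of_forall fun x => (hcc _ _ x).aestronglyMeasurable)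
    ((hcc _ _ x).intervalIntegrable _ _) (hcc _ _ x).aestronglyMeasurable
    (Eventually.of_forall fun θ hθ x' hx' => ?_) intervalIntegrable_const
    (Eventually.of_forall fun θ hθ x' hx' => ?_)).2
  · rw [Set.uIoc_of_le zero_le_one] at hθ
    have hx'' : |x' - x| < 1 := by simpa [Real.dist_eq] using hx'
    have habs : |x'| ≤ |x| + 1 := by
      have := abs_sub_abs_le_abs_sub x' x
      linarith
    have hb : |z + θ * (x' - z)| ≤ r := by
      refine (abs_add_le _ _).trans ?_
      rw [abs_mul, abs_of_pos hθ.1, hr]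
      have h1 : |x' - z| ≤ |x| + 1 + |z| := (abs_sub _ _).trans (by linarith)
      nlinarith [abs_nonneg (x' - z), hθ.1, hθ.2]
    rw [norm_mul, norm_pow, Complex.norm_real, Real.norm_eq_abs, abs_of_pos hθ.1]
    have h2 := hC _ (abs_le.1 hb)
    have h3 : θ ^ (k + 1) ≤ 1 := pow_le_one₀ hθ.1.le hθ.2
    have h4 : 0 ≤ θ ^ (k + 1) := pow_nonneg hθ.1.le _
    nlinarith [norm_nonneg (iteratedDeriv (k + 2) h (z + θ * (x' - z)))]
  · have h1 : HasDerivAt (fun x : ℝ => z + θ * (x - z)) θ x' := by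
      simpa using (((hasDerivAt_id x').sub_const z).const_mul θ).const_add z
    have h2 := (hasDerivAt_iteratedDeriv hh (k + 1) (z + θ * (x' - z))).scomp x' h1
    have h3 := h2.const_mul ((θ : ℂ) ^ k)
    refine h3.congr_deriv ?_
    rw [Complex.real_smul]
    ring

lemma dd_eq (h : ℝ → ℂ) (z : ℝ) : dd h z =
    fun x => ∫ θ in (0 : ℝ)..1, (θ : ℂ) ^ 0 * iteratedDeriv (0 + 1) h (z + θ * (x - z)) := by
  ext x; simp [dd, iteratedDeriv_one]

lemma contDiff_dd {h : ℝ → ℂ} (hh : ContDiff ℝ ∞ h) (z : ℝ) : ContDiff ℝ ∞ (dd h z) := by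
  rw [dd_eq]
  exact contDiff_of_hasDerivAt_succ (hasDerivAt_integral_pow_mul hh z)

lemma iteratedDeriv_dd {h : ℝ → ℂ} (hh : ContDiff ℝ ∞ h) (z : ℝ) (k : ℕ) (x : ℝ) :
    iteratedDeriv k (dd h z) x =
      ∫ θ in (0 : ℝ)..1, (θ : ℂ) ^ k * iteratedDeriv (k + 1) h (z + θ * (x - z)) := by
  rw [dd_eq]
  exact congrFun (iteratedDeriv_of_hasDerivAt_succ (hasDerivAt_integral_pow_mul hh z) k) x

/-- The fundamental theorem of calculus along the segment from `z` to `x`. The integral form of `dd`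
is smooth across the diagonal, which the quotient is not by definition. -/
lemma sub_mul_dd {h : ℝ → ℂ} (hh : ContDiff ℝ ∞ h) (z x : ℝ) :
    ((x - z : ℝ) : ℂ) * dd h z x = h x - h z := by
  have hd : Differentiable ℝ h := hh.differentiable (by simp)
  have hc : Continuous (deriv h) := hh.continuous_deriv (by simp)
  have := intervalIntegral.integral_unitInterval_deriv_eq_sub (f := h) (f' := deriv h)
    (z₀ := z) (z₁ := x - z) (hc.comp (by fun_prop)).continuousOn
    (fun t _ => (hd _).hasDerivAt)
  rw [← Complex.real_smul]
  simpa [dd] using this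

lemma dd_self (h : ℝ → ℂ) (z : ℝ) : dd h z z = deriv h z := by simp [dd]

lemma dd_add_const (h : ℝ → ℂ) (c : ℂ) (z : ℝ) : dd (fun x => h x + c) z = dd h z := by
  ext x; simp [dd]

/-! ### Divided differences and multiplication by `u` -/

lemma contDiff_u : ContDiff ℝ ∞ u := by
  unfold u
  exact Complex.ofRealCLM.contDiff.sub contDiff_const

lemma hasDerivAt_u (x : ℝ) : HasDerivAt u 1 x := by
  unfold u
  simpa using (Complex.ofRealCLM.hasDerivAt (x := x)).sub_const Complex.I

lemma u_ne_zero (x : ℝ) : u x ≠ 0 := by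
  intro h
  have := congrArg Complex.im h
  simp [u] at this

/-- Leibniz rule for the divided difference of `u h`. -/
lemma dd_u_mul {h : ℝ → ℂ} (hh : ContDiff ℝ ∞ h) (z x : ℝ) :
    dd (fun x => u x * h x) z x = u x * dd h z x + h z := by
  have huh : ContDiff ℝ ∞ (fun x => u x * h x) := contDiff_u.mul hh
  rcases eq_or_ne x z with rfl | hne
  · have hd : Differentiable ℝ h := hh.differentiable (by simp)
    rw [dd_self, dd_self]
    refine ((hasDerivAt_u x).mul (hd x).hasDerivAt).deriv.trans ?_
    ring
  · have hne' : ((x - z : ℝ) : ℂ) ≠ 0 := by exact_mod_cast sub_ne_zero.2 hne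
    apply mul_left_cancel₀ hne'
    rw [sub_mul_dd huh, mul_add, mul_left_comm, sub_mul_dd hh]
    simp only [u]
    push_cast
    ring

/-- Iterated divided differences with respect to a list of nodes. -/
def ddl (g : ℝ → ℂ) : List ℝ → ℝ → ℂ
  | [] => g
  | z :: l => dd (ddl g l) z

lemma contDiff_ddl {g : ℝ → ℂ} (hg : ContDiff ℝ ∞ g) : ∀ l, ContDiff ℝ ∞ (ddl g l)
  | [] => hg
  | z :: l => contDiff_dd (contDiff_ddl hg l) z

/-- As `u` is affine with slope one, each further difference kills the old constant and creates a
new one, independent of `x`. -/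
lemma ddl_u_mul {g : ℝ → ℂ} (hg : ContDiff ℝ ∞ g) (l : List ℝ) :
    ∃ c, ∀ x, ddl (fun x => u x * g x) l x = u x * ddl g l x + c := by
  induction l with
  | nil => exact ⟨0, fun x => by simp [ddl]⟩
  | cons z l ih =>
    obtain ⟨c, hc⟩ := ih
    refine ⟨ddl g l z, fun x => ?_⟩
    change dd (ddl (fun x => u x * g x) l) z x = _
    rw [funext hc, dd_add_const, dd_u_mul (contDiff_ddl hg l)]
    rfl

/-- The divided difference `(f u ^ p)^{[p]} (x, z₁, …, z_p)`. -/
def phi (f : ℝ → ℂ) (x : ℝ) (l : List ℝ) : ℂ := ddl (fun x => f x * u x ^ l.length) l x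

/-- One more node comes with one more factor `u`. The constant from `ddl_u_mul` cancels between `x₀`
and `x₁`. -/
lemma sub_mul_phi_cons {f : ℝ → ℂ} (hf : ContDiff ℝ ∞ f) (x₀ x₁ : ℝ) (l : List ℝ) :
    ((x₀ - x₁ : ℝ) : ℂ) * phi f x₀ (x₁ :: l) = u x₀ * phi f x₀ l - u x₁ * phi f x₁ l := by
  have hg : ContDiff ℝ ∞ (fun x => f x * u x ^ l.length) := hf.mul (contDiff_u.pow _)
  have hg' : ContDiff ℝ ∞ (fun x => u x * (f x * u x ^ l.length)) := contDiff_u.mul hg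
  obtain ⟨c, hc⟩ := ddl_u_mul hg l
  have h1 : phi f x₀ (x₁ :: l) = dd (ddl (fun x => u x * (f x * u x ^ l.length)) l) x₁ x₀ := by
    have : (fun x => f x * u x ^ (x₁ :: l).length) = fun x => u x * (f x * u x ^ l.length) := by
      ext x; rw [List.length_cons, pow_succ]; ring
    rw [phi, this, ddl]
  rw [h1, sub_mul_dd (contDiff_ddl hg' l), hc, hc, phi, phi]
  ring

/-- The pairing of a sequence of frequencies with a list of nodes. -/
def pair : (ℕ → ℝ) → List ℝ → ℝ
  | _, [] => 0
  | y, a :: l => y 0 * a + pair (fun i => y (i + 1)) l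

lemma pair_append_singleton (y : ℕ → ℝ) (l : List ℝ) (a : ℝ) :
    pair y (l ++ [a]) = pair y l + y l.length * a := by
  induction l generalizing y with
  | nil => simp [pair]
  | cons b l ih => simp [pair, ih]; ring

/-- Multiplier bound for divided differences whose top derivative is a Fourier transform. -/
lemma norm_sum_ddl_smul_le {Y : Type*} [NormedAddCommGroup Y] [NormedSpace ℂ Y] [CompleteSpace Y]
    {g : ℝ → ℂ} (hg : ContDiff ℝ ∞ g) {N : ℕ} {ν : ComplexMeasure ℝ}
    (hν : IsFourierOf (iteratedDeriv N g) ν) (p j : ℕ) (hN : p + j = N)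
    {κ : Type*} [Fintype κ] (L : κ → Y) (x : κ → ℝ) (z : κ → List ℝ)
    (hz : ∀ k, (z k).length = p) (M : ℝ)
    (hM : ∀ (y₀ : ℝ) (y : ℕ → ℝ),
      ‖∑ k, Complex.exp (Complex.I * (y₀ * x k + pair y (z k) : ℝ)) • L k‖ ≤ M) :
    ‖∑ k, iteratedDeriv j (ddl g (z k)) (x k) • L k‖
      ≤ M * ν.variation.real Set.univ * (j.factorial / (p + j).factorial) := by
  induction p generalizing j x z with
  | zero =>
    have hz' : ∀ k, z k = [] := fun k => List.length_eq_zero_iff.1 (hz k)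
    obtain rfl : j = N := by omega
    simp only [hz', ddl]
    have := norm_sum_fourier_smul_le hν L x M (fun y => by
      have := hM y (fun _ => 0)
      simpa [hz', pair] using this)
    have hj : (j.factorial : ℝ) / (0 + j).factorial = 1 := by
      rw [zero_add]; exact div_self (by positivity)
    rw [hj, mul_one]
    exact this
  | succ p ih =>
    have hz' : ∀ k, ∃ a l, z k = a :: l ∧ l.length = p := by
      intro k
      have := hz k
      match hzk : z k with
      | [] => rw [hzk] at this; simp at this
      | a :: l => rw [hzk] at this; exact ⟨a, l, rfl, by simpa using this⟩
    choose a w haw hw using hz'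
    have hM0 : 0 ≤ M := (norm_nonneg _).trans (hM 0 (fun _ => 0))
    have hcont : ∀ k, Continuous fun θ : ℝ => ((θ : ℂ) ^ j *
        iteratedDeriv (j + 1) (ddl g (w k)) (a k + θ * (x k - a k))) • L k := fun k =>
      ((Complex.continuous_ofReal.pow j).mul
        (((contDiff_ddl hg (w k)).continuous_iteratedDeriv (j + 1)
          (by exact_mod_cast le_top)).comp (by fun_prop))).smul continuous_const
    have h1 : ∑ k, iteratedDeriv j (ddl g (z k)) (x k) • L k = ∫ θ in (0 : ℝ)..1,
        ∑ k, ((θ : ℂ) ^ j * iteratedDeriv (j + 1) (ddl g (w k)) (a k + θ * (x k - a k))) • L k := by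
      rw [intervalIntegral.integral_finsetSum fun k _ => (hcont k).intervalIntegrable _ _]
      refine Finset.sum_congr rfl fun k _ => ?_
      rw [intervalIntegral.integral_smul_const, haw k, ddl,
        iteratedDeriv_dd (contDiff_ddl hg (w k))]
    -- `D` is the bound for one more derivative and one node fewer; the factor `∫ θ ^ j = 1 / (j +
    -- 1)` below turns `(j + 1)!` into `j!`.
    set D := M * ν.variation.real Set.univ * ((j + 1).factorial / (p + (j + 1)).factorial) with hD
    have h2 : ∀ θ : ℝ, ‖∑ k, iteratedDeriv (j + 1) (ddl g (w k)) (a k + θ * (x k - a k)) • L k‖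
        ≤ D := by
      intro θ
      refine ih (j + 1) (by omega) _ w hw fun y₀ y => ?_
      -- An exponential at the convex combination of `a k` and `x k` splits into exponentials of
      -- frequencies `y₀ (1 - θ)` and `y₀ θ`; the other frequencies shift by one place.
      have := hM (y₀ * θ) (fun i => if i = 0 then y₀ * (1 - θ) else y (i - 1))
      convert this using 6 with k
      simp only [haw k, pair, if_true, Nat.add_eq_zero_iff, one_ne_zero, and_false, if_false,
        Nat.add_sub_cancel]
      push_cast
      ring
    have hint : ∫ θ in (0 : ℝ)..1, θ ^ j * D = D / (j + 1) := by
      rw [intervalIntegral.integral_mul_const, integral_pow]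
      simp
      ring
    rw [h1]
    refine (intervalIntegral.norm_integral_le_of_norm_le (g := fun θ => θ ^ j * D) zero_le_one
      (Eventually.of_forall fun θ hθ => ?_)
      (Continuous.intervalIntegrable (by fun_prop) _ _)).trans ?_
    · simp_rw [mul_smul]
      rw [← Finset.smul_sum, norm_smul, norm_pow, Complex.norm_real, Real.norm_eq_abs,
        abs_of_pos hθ.1]
      exact mul_le_mul_of_nonneg_left (h2 θ) (pow_nonneg hθ.1.le _)
    · rw [hint, hD, show p + (j + 1) = p + 1 + j by ring, Nat.factorial_succ]
      apply le_of_eq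
      push_cast
      field_simp

end RelTaylor
end

noncomputable section

namespace RelTaylor

/-! ### Noncommutative Taylor expansion for operators with finite spectral resolutions -/

/-- The alternating sum of `χ` over all sublists. -/
def alt : (List ℝ → ℂ) → List ℝ → ℂ
  | χ, [] => χ []
  | χ, a :: l => alt (fun J => χ (a :: J)) l - alt χ l

lemma alt_congr_mul_sub {χ₁ χ₂ χ₃ χ₄ : List ℝ → ℂ} {c d : ℂ}
    (h : ∀ J, c * (χ₁ J - χ₂ J) = d * (χ₃ J - χ₄ J)) (l : List ℝ) :
    c * (alt χ₁ l - alt χ₂ l) = d * (alt χ₃ l - alt χ₄ l) := by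
  induction l generalizing χ₁ χ₂ χ₃ χ₄ with
  | nil => exact h []
  | cons a l ih =>
    simp only [alt]
    have h1 := ih h
    have h2 := ih (χ₁ := fun J => χ₁ (a :: J)) (χ₂ := fun J => χ₂ (a :: J))
      (χ₃ := fun J => χ₃ (a :: J)) (χ₄ := fun J => χ₄ (a :: J)) (fun J => h (a :: J))
    linear_combination h2 - h1

/-- The symbol `f^{[n]}(x₀, …, xₙ) u(x₁) ⋯ u(xₙ)` satisfies the recursion of divided differences. -/
lemma sub_mul_alt_phi_cons {f : ℝ → ℂ} (hf : ContDiff ℝ ∞ f) (x₀ x₁ : ℝ) (l : List ℝ) :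
    ((x₀ - x₁ : ℝ) : ℂ) * alt (phi f x₀) (x₁ :: l)
      = u x₁ * (alt (phi f x₀) l - alt (phi f x₁) l) := by
  -- By definition `alt` at `x₁ :: l` is a difference of two alternating sums over `l`. For each
  -- sublist, `x₀ - x₁ = u x₀ - u x₁` cancels the terms with `u x₀`.
  refine alt_congr_mul_sub (fun J => ?_) l
  rw [mul_sub, sub_mul_phi_cons hf]
  simp only [u]
  push_cast
  ring

/-- Bounds of the Taylor coefficients in terms of bounds `b p` for the symbols `(f uᵖ)^{[p]}`. -/
def beta (b : ℕ → ℝ) : ℕ → ℕ → ℝ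
  | 0, p => b p
  | n + 1, p => beta b n (p + 1) + beta b n p

lemma beta_nonneg {b : ℕ → ℝ} (hb : ∀ p, 0 ≤ b p) (n p : ℕ) : 0 ≤ beta b n p := by
  induction n generalizing p with
  | zero => exact hb p
  | succ n ih => exact add_nonneg (ih _) (ih _)

/-- `beta b n p` is `∑ q, (n choose q) b (p + q)`, so this is the binomial theorem. -/
lemma beta_le {b : ℕ → ℝ} {c C : ℝ} (hb : ∀ p, b p ≤ c * C ^ p) (n p : ℕ) :
    beta b n p ≤ c * C ^ p * (1 + C) ^ n := by
  induction n generalizing p with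
  | zero => simpa [beta] using hb p
  | succ n ih =>
    refine (add_le_add (ih (p + 1)) (ih p)).trans (le_of_eq ?_)
    ring

/-! ### Words in `K` and the spectral projections -/

section Core

universe v

variable {𝒜 : Type*} [NormedRing 𝒜] [NormedAlgebra ℂ 𝒜]
variable {ι ι₀ : Type v} [Fintype ι] [Fintype ι₀]

/-- `∑ χ(λ_{i₁}, …, λ_{iₙ}) K P_{i₁} K P_{i₂} ⋯ K P_{iₙ}`. -/
def word (K : 𝒜) (P : ι → 𝒜) (lam : ι → ℝ) : ℕ → (List ℝ → ℂ) → 𝒜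
  | 0, χ => χ [] • 1
  | n + 1, χ => ∑ i, K * P i * word K P lam n (fun l => χ (lam i :: l))

lemma word_congr_mul_sub (K : 𝒜) (P : ι → 𝒜) (lam : ι → ℝ) (n : ℕ) {χ₁ χ₂ χ₃ : List ℝ → ℂ} {c d : ℂ}
    (h : ∀ J, c * χ₁ J = d * (χ₂ J - χ₃ J)) :
    c • word K P lam n χ₁ = d • (word K P lam n χ₂ - word K P lam n χ₃) := by
  induction n generalizing χ₁ χ₂ χ₃ with
  | zero => simp only [word]; rw [smul_smul, h, ← sub_smul, smul_smul]
  | succ n ih =>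
    simp only [word, ← Finset.sum_sub_distrib, Finset.smul_sum]
    refine Finset.sum_congr rfl fun i _ => ?_
    rw [← mul_smul_comm, ih (fun J => h (lam i :: J)), ← mul_sub, mul_smul_comm]

/-- Where the sublist omits the first eigenvalue, the symbol does not depend on `i`, and `∑ P i = 1`
removes the projection. -/
lemma word_alt_succ (K : 𝒜) (P : ι → 𝒜) (lam : ι → ℝ) (hP : ∑ i, P i = 1) (n : ℕ)
    (χ : List ℝ → ℂ) :
    word K P lam (n + 1) (alt χ) =
      (∑ i, K * P i * word K P lam n (alt fun J => χ (lam i :: J))) - K * word K P lam n (alt χ) := by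
  have : ∀ i, word K P lam n (fun l => alt χ (lam i :: l)) =
      word K P lam n (alt fun J => χ (lam i :: J)) - word K P lam n (alt χ) := by
    intro i
    have := word_congr_mul_sub K P lam n (c := 1) (d := 1) (χ₁ := fun l => alt χ (lam i :: l))
      (χ₂ := alt fun J => χ (lam i :: J)) (χ₃ := alt χ) (fun J => by simp [alt])
    simpa using this
  simp only [word, this, mul_sub, Finset.sum_sub_distrib]
  rw [← Finset.sum_mul, ← Finset.mul_sum, hP, mul_one]

/-- `∑ f^{[n]}(λ⁰_j, λ_{i₁}, …, λ_{iₙ}) u(λ_{i₁}) ⋯ u(λ_{iₙ}) P⁰_j K P_{i₁} ⋯ K P_{iₙ}`. -/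
def taylorOp (f : ℝ → ℂ) (K : 𝒜) (P : ι → 𝒜) (lam : ι → ℝ) (P₀ : ι₀ → 𝒜) (lam₀ : ι₀ → ℝ) (n : ℕ) :
    𝒜 :=
  ∑ j, P₀ j * word K P lam n (alt (phi f (lam₀ j)))

lemma taylorOp_zero (f : ℝ → ℂ) (K : 𝒜) (P : ι → 𝒜) (lam : ι → ℝ) (P₀ : ι₀ → 𝒜) (lam₀ : ι₀ → ℝ) :
    taylorOp f K P lam P₀ lam₀ 0 = ∑ j, f (lam₀ j) • P₀ j := by
  simp [taylorOp, word, alt, phi, ddl]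

/-- Inserting `∑ P i = 1` in one term and `∑ P₀ j = 1` in the other writes both as sums over the
products `P₀ j * P i`. The symbol difference is `(λ⁰_j - λ_i) / u(λ_i)` times the next symbol, and
`hK`, the compressed form of `(A + sB) - A = s K (A - i)`, converts this factor into `s K`. -/
lemma taylorOp_sub {f : ℝ → ℂ} (hf : ContDiff ℝ ∞ f) (K : 𝒜) (P : ι → 𝒜) (lam : ι → ℝ)
    (P₀ : ι₀ → 𝒜) (lam₀ : ι₀ → ℝ) (hP : ∑ i, P i = 1) (hP₀ : ∑ j, P₀ j = 1) (s : ℂ)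
    (hK : ∀ j i, s • (u (lam i) • (P₀ j * K * P i)) = ((lam₀ j - lam i : ℝ) : ℂ) • (P₀ j * P i))
    (n : ℕ) :
    taylorOp f K P lam P₀ lam₀ n - taylorOp f K P lam P lam n
      = s • taylorOp f K P lam P₀ lam₀ (n + 1) := by
  have h1 : taylorOp f K P lam P₀ lam₀ n
      = ∑ j, ∑ i, P₀ j * P i * word K P lam n (alt (phi f (lam₀ j))) := by
    refine Finset.sum_congr rfl fun j _ => ?_
    rw [← Finset.sum_mul, ← Finset.mul_sum, hP, mul_one]
  have h2 : taylorOp f K P lam P lam n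
      = ∑ j, ∑ i, P₀ j * P i * word K P lam n (alt (phi f (lam i))) := by
    rw [Finset.sum_comm]
    refine Finset.sum_congr rfl fun i _ => ?_
    rw [← Finset.sum_mul, ← Finset.sum_mul, hP₀, one_mul]
  rw [h1, h2, ← Finset.sum_sub_distrib, taylorOp, Finset.smul_sum]
  refine Finset.sum_congr rfl fun j _ => ?_
  rw [← Finset.sum_sub_distrib, word, Finset.mul_sum, Finset.smul_sum]
  refine Finset.sum_congr rfl fun i _ => ?_
  have h3 := word_congr_mul_sub K P lam n (c := ((lam₀ j - lam i : ℝ) : ℂ)) (d := u (lam i))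
    (χ₁ := fun l => alt (phi f (lam₀ j)) (lam i :: l)) (χ₂ := alt (phi f (lam₀ j)))
    (χ₃ := alt (phi f (lam i))) (fun J => sub_mul_alt_phi_cons hf _ _ J)
  have hu := u_ne_zero (lam i)
  have h4 : P₀ j * K * P i = (u (lam i))⁻¹ • (u (lam i) • (P₀ j * K * P i)) := by
    rw [smul_smul, inv_mul_cancel₀ hu, one_smul]
  set w₁ := word K P lam n (alt (phi f (lam₀ j)))
  set w₂ := word K P lam n (alt (phi f (lam i)))
  set w₃ := word K P lam n (fun l => alt (phi f (lam₀ j)) (lam i :: l))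
  calc P₀ j * P i * w₁ - P₀ j * P i * w₂
      = (u (lam i))⁻¹ • (P₀ j * P i * (u (lam i) • (w₁ - w₂))) := by
        rw [mul_smul_comm, smul_smul, inv_mul_cancel₀ hu, one_smul, mul_sub]
    _ = (u (lam i))⁻¹ • ((((lam₀ j - lam i : ℝ) : ℂ) • (P₀ j * P i)) * w₃) := by
        rw [← h3, mul_smul_comm, smul_mul_assoc]
    _ = s • (P₀ j * (K * P i * w₃)) := by
        rw [← hK, smul_mul_assoc, smul_mul_assoc, smul_comm s, smul_smul, inv_mul_cancel₀ hu,
          one_smul, mul_assoc, mul_assoc, mul_assoc]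

/-- Induction on the number `n` of letters not yet expanded. By `word_alt_succ` the next eigenvalue
is either appended to the nodes (`L` becomes `L K P i`, and the index set `κ × ι`) or dropped (`L`
becomes `L K`). Both cost a factor `‖K‖`, because an exponential in the new node factors out as a
contraction. The two cases are the recursion of `beta`; at `n = 0` the multiplier bound supplies
`1/p!`. -/
lemma norm_sum_mul_word_alt_le [CompleteSpace 𝒜] {f : ℝ → ℂ} (hf : ContDiff ℝ ∞ f) (μ : ℕ → ComplexMeasure ℝ)
    (hμ : ∀ n, IsFourierOf (weightedDeriv f n) (μ n)) {b : ℕ → ℝ}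
    (hb : ∀ p, (μ p).variation.real Set.univ / p.factorial ≤ b p)
    (K : 𝒜) (P : ι → 𝒜) (lam : ι → ℝ) (hP : ∑ i, P i = 1)
    (hP' : ∀ y : ℝ, ‖∑ i, Complex.exp (Complex.I * (y * lam i : ℝ)) • P i‖ ≤ 1)
    (n p : ℕ) {κ : Type v} [Fintype κ] (L : κ → 𝒜) (x : κ → ℝ) (z : κ → List ℝ)
    (hz : ∀ k, (z k).length = p) (M : ℝ)
    (hM : ∀ (y₀ : ℝ) (y : ℕ → ℝ),
      ‖∑ k, Complex.exp (Complex.I * (y₀ * x k + pair y (z k) : ℝ)) • L k‖ ≤ M) :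
    ‖∑ k, L k * word K P lam n (alt fun J => phi f (x k) (z k ++ J))‖
      ≤ M * ‖K‖ ^ n * beta b n p := by
  have hM0 : 0 ≤ M := (norm_nonneg _).trans (hM 0 (fun _ => 0))
  induction n generalizing p κ M with
  | zero =>
    have hg : ContDiff ℝ ∞ (fun x => f x * u x ^ p) := hf.mul (contDiff_u.pow _)
    have := norm_sum_ddl_smul_le hg (hμ p) p 0 rfl L x z hz M hM
    simp only [iteratedDeriv_zero, Nat.factorial_zero, Nat.cast_one, add_zero] at this
    simp only [word, alt, List.append_nil, mul_smul_comm, mul_one, pow_zero, phi, hz, beta]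
    refine this.trans ?_
    rw [mul_assoc, ← div_eq_mul_one_div]
    exact mul_le_mul_of_nonneg_left (hb p) hM0
  | succ n ih =>
    simp only [word_alt_succ K P lam hP, mul_sub, Finset.sum_sub_distrib]
    have h1 := ih p (fun k => L k * K) x z hz (M * ‖K‖) (fun y₀ y => by
      simp_rw [← smul_mul_assoc]
      rw [← Finset.sum_mul]
      exact (norm_mul_le _ _).trans (mul_le_mul_of_nonneg_right (hM y₀ y) (norm_nonneg _)))
      (by positivity)
    have h2 := ih (p + 1) (κ := κ × ι) (fun k => L k.1 * K * P k.2) (fun k => x k.1)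
      (fun k => z k.1 ++ [lam k.2]) (fun k => by simp [hz]) (M * ‖K‖) (fun y₀ y => by
        have : ∑ k : κ × ι, Complex.exp (Complex.I *
            (y₀ * x k.1 + pair y (z k.1 ++ [lam k.2]) : ℝ)) • (L k.1 * K * P k.2)
            = (∑ k, Complex.exp (Complex.I * (y₀ * x k + pair y (z k) : ℝ)) • L k) * K *
              ∑ i, Complex.exp (Complex.I * (y p * lam i : ℝ)) • P i := by
          rw [Fintype.sum_prod_type, Finset.sum_mul, Finset.sum_mul]
          refine Finset.sum_congr rfl fun k _ => ?_
          rw [Finset.mul_sum]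
          refine Finset.sum_congr rfl fun i _ => ?_
          rw [mul_smul_comm, smul_mul_assoc, smul_mul_assoc, smul_smul, ← Complex.exp_add,
            pair_append_singleton, hz]
          congr 2
          push_cast
          ring
        rw [this]
        refine (norm_mul_le _ _).trans ?_
        refine (mul_le_mul (norm_mul_le _ _) (hP' _) (norm_nonneg _) (by positivity)).trans ?_
        rw [mul_one]
        exact mul_le_mul_of_nonneg_right (hM y₀ y) (norm_nonneg _))
      (by positivity)
    have e1 : ∑ k, L k * ∑ i, K * P i * word K P lam n
        (alt fun J => phi f (x k) (z k ++ lam i :: J))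
        = ∑ k : κ × ι, L k.1 * K * P k.2 * word K P lam n
          (alt fun J => phi f (x k.1) (z k.1 ++ [lam k.2] ++ J)) := by
      rw [Fintype.sum_prod_type]
      refine Finset.sum_congr rfl fun k _ => ?_
      rw [Finset.mul_sum]
      refine Finset.sum_congr rfl fun i _ => ?_
      simp [mul_assoc]
    have e2 : ∑ k, L k * (K * word K P lam n (alt fun J => phi f (x k) (z k ++ J)))
        = ∑ k, L k * K * word K P lam n (alt fun J => phi f (x k) (z k ++ J)) := by
      simp [mul_assoc]
    rw [e1, e2]
    refine (norm_sub_le _ _).trans ((add_le_add h2 h1).trans (le_of_eq ?_))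
    rw [beta]
    ring

lemma norm_taylorOp_le [CompleteSpace 𝒜] {f : ℝ → ℂ} (hf : ContDiff ℝ ∞ f) (μ : ℕ → ComplexMeasure ℝ)
    (hμ : ∀ n, IsFourierOf (weightedDeriv f n) (μ n)) {b : ℕ → ℝ}
    (hb : ∀ p, (μ p).variation.real Set.univ / p.factorial ≤ b p)
    (K : 𝒜) (P : ι → 𝒜) (lam : ι → ℝ) (hP : ∑ i, P i = 1)
    (hP' : ∀ y : ℝ, ‖∑ i, Complex.exp (Complex.I * (y * lam i : ℝ)) • P i‖ ≤ 1)
    (P₀ : ι₀ → 𝒜) (lam₀ : ι₀ → ℝ)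
    (hP₀' : ∀ y : ℝ, ‖∑ i, Complex.exp (Complex.I * (y * lam₀ i : ℝ)) • P₀ i‖ ≤ 1) (n : ℕ) :
    ‖taylorOp f K P lam P₀ lam₀ n‖ ≤ ‖K‖ ^ n * beta b n 0 := by
  have := norm_sum_mul_word_alt_le hf μ hμ hb K P lam hP hP' n 0 P₀ lam₀ (fun _ => [])
    (fun _ => rfl) 1 (fun y₀ y => by simpa [pair] using hP₀' y₀)
  simpa [taylorOp] using this

/-- Taylor expansion with remainder. -/
lemma taylorOp_expansion {f : ℝ → ℂ} (hf : ContDiff ℝ ∞ f) (K : 𝒜) (P : ι → 𝒜) (lam : ι → ℝ)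
    (P₀ : ι₀ → 𝒜) (lam₀ : ι₀ → ℝ) (hP : ∑ i, P i = 1) (hP₀ : ∑ j, P₀ j = 1) (s : ℂ)
    (hK : ∀ j i, s • (u (lam i) • (P₀ j * K * P i)) = ((lam₀ j - lam i : ℝ) : ℂ) • (P₀ j * P i))
    (n : ℕ) :
    ∑ j, f (lam₀ j) • P₀ j - ∑ k ∈ Finset.range n, s ^ k • taylorOp f K P lam P lam k
      = s ^ n • taylorOp f K P lam P₀ lam₀ n := by
  induction n with
  | zero => simp [taylorOp_zero]
  | succ n ih =>
    rw [Finset.sum_range_succ, ← sub_sub, ih, ← smul_sub, taylorOp_sub hf K P lam P₀ lam₀ hP hP₀ s hK,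
      smul_smul, pow_succ]

end Core

end RelTaylor
end

noncomputable section

namespace RelTaylor

/-! ### Finite spectral resolutions -/

section Spectral

variable {X : Type*} [NormedAddCommGroup X] [InnerProductSpace ℂ X]

/-- A finite resolution of the identity diagonalizing `A`. -/
structure SpectralRes (A : X →L[ℂ] X) where
  /-- the number of projections -/
  dim : ℕ
  /-- the eigenvalues -/
  lam : Fin dim → ℝ
  /-- the projections -/
  P : Fin dim → X →L[ℂ] X
  sum_P : ∑ i, P i = 1
  P_mul_P : ∀ i j, P i * P j = if i = j then P i else 0
  inner_P : ∀ i x y, inner ℂ (P i x) y = inner ℂ x (P i y)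
  mul_P : ∀ i, A * P i = (lam i : ℂ) • P i
  P_mul : ∀ i, P i * A = (lam i : ℂ) • P i

/-- The spectral resolution given by an eigenvector basis. -/
def spectralRes [FiniteDimensional ℂ X] (A : X →L[ℂ] X) (hA : (A : X →ₗ[ℂ] X).IsSymmetric) : SpectralRes A where
  dim := Module.finrank ℂ X
  lam := hA.eigenvalues rfl
  P i := InnerProductSpace.rankOne ℂ (hA.eigenvectorBasis rfl i) (hA.eigenvectorBasis rfl i)
  sum_P := by
    ext x
    simp only [sum_apply, InnerProductSpace.rankOne_apply,
      one_apply_eq_self]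
    exact (hA.eigenvectorBasis rfl).sum_repr' x
  P_mul_P i j := by
    ext x
    simp only [mul_apply_eq_comp, InnerProductSpace.rankOne_apply, inner_smul_right,
      orthonormal_iff_ite.1 (hA.eigenvectorBasis rfl).orthonormal]
    split_ifs with h
    · subst h; simp
    · simp
  inner_P i x y := by
    simp only [InnerProductSpace.rankOne_apply, inner_smul_left, inner_smul_right,
      inner_conj_symm]
    ring
  mul_P i := by
    ext x
    simp only [mul_apply_eq_comp, InnerProductSpace.rankOne_apply, map_smul,
      smul_apply]
    rw [smul_comm]
    congr 1
    exact hA.apply_eigenvectorBasis rfl i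
  P_mul i := by
    ext x
    simp only [mul_apply_eq_comp, InnerProductSpace.rankOne_apply,
      smul_apply]
    have h : inner ℂ (hA.eigenvectorBasis rfl i) (A x)
        = (hA.eigenvalues rfl i : ℂ) * inner ℂ (hA.eigenvectorBasis rfl i) x := by
      have h1 := hA (hA.eigenvectorBasis rfl i) x
      have h2 := hA.apply_eigenvectorBasis rfl i
      simp only [ContinuousLinearMap.coe_coe] at h1 h2
      rw [← h1, h2, inner_smul_left]
      simp
    rw [h, smul_smul]

namespace SpectralRes

variable {A : X →L[ℂ] X} (S : SpectralRes A)

/-- The functional calculus of a finite spectral resolution. -/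
def fc (g : ℝ → ℂ) : X →L[ℂ] X := ∑ i, g (S.lam i) • S.P i

lemma fc_add (g h : ℝ → ℂ) : S.fc (fun x => g x + h x) = S.fc g + S.fc h := by
  simp [fc, add_smul, Finset.sum_add_distrib]

lemma fc_sub (g h : ℝ → ℂ) : S.fc (fun x => g x - h x) = S.fc g - S.fc h := by
  simp [fc, sub_smul, Finset.sum_sub_distrib]

lemma fc_mul (g h : ℝ → ℂ) : S.fc (fun x => g x * h x) = S.fc g * S.fc h := by
  simp only [fc, Finset.sum_mul, Finset.mul_sum, smul_mul_smul_comm, S.P_mul_P]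
  simp

lemma fc_const (c : ℂ) : S.fc (fun _ => c) = c • 1 := by
  rw [fc, ← Finset.smul_sum, S.sum_P]

lemma fc_u : S.fc u = A - Complex.I • 1 := by
  have h1 : A = ∑ i, (S.lam i : ℂ) • S.P i := by
    conv_lhs => rw [← mul_one A, ← S.sum_P, Finset.mul_sum]
    exact Finset.sum_congr rfl fun i _ => S.mul_P i
  have h2 : (Complex.I • 1 : X →L[ℂ] X) = ∑ i, Complex.I • S.P i := by
    rw [← Finset.smul_sum, S.sum_P]
  rw [h2]
  nth_rewrite 2 [h1]
  rw [← Finset.sum_sub_distrib]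
  simp [fc, u, sub_smul]

lemma norm_sq_sum (x : X) (c : Fin S.dim → ℂ) :
    ‖∑ i, c i • S.P i x‖ ^ 2 = ∑ i, ‖c i‖ ^ 2 * ‖S.P i x‖ ^ 2 := by
  have hort : ∀ i j, i ≠ j → inner ℂ (c i • S.P i x) (c j • S.P j x) = 0 := by
    intro i j hij
    have : S.P i (S.P j x) = 0 := by
      have := congrArg (fun T : X →L[ℂ] X => T x) (S.P_mul_P i j)
      simpa [hij] using this
    rw [inner_smul_left, inner_smul_right, S.inner_P, this]
    simp
  rw [← inner_self_eq_norm_sq (𝕜 := ℂ), sum_inner, map_sum]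
  refine Finset.sum_congr rfl fun i _ => ?_
  rw [inner_sum, Finset.sum_eq_single i (fun j _ hj => hort i j hj.symm) (by simp),
    inner_self_eq_norm_sq, norm_smul, mul_pow]

lemma norm_fc_le (g : ℝ → ℂ) {M : ℝ} (hM0 : 0 ≤ M) (hM : ∀ x, ‖g x‖ ≤ M) : ‖S.fc g‖ ≤ M := by
  refine ContinuousLinearMap.opNorm_le_bound _ hM0 fun x => ?_
  have h1 : S.fc g x = ∑ i, g (S.lam i) • S.P i x := by simp [fc]
  have h2 : x = ∑ i, (1 : ℂ) • S.P i x := by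
    have := congrArg (fun T : X →L[ℂ] X => T x) S.sum_P
    simpa using this.symm
  have h3 : ‖x‖ ^ 2 = ∑ i, ‖S.P i x‖ ^ 2 := by
    conv_lhs => rw [h2]
    rw [S.norm_sq_sum]
    simp
  refine le_of_sq_le_sq ?_ (by positivity)
  rw [h1, S.norm_sq_sum, mul_pow, h3, Finset.mul_sum]
  refine Finset.sum_le_sum fun i _ => ?_
  have := hM (S.lam i)
  gcongr

lemma norm_exp_le (y : ℝ) :
    ‖∑ i, Complex.exp (Complex.I * (y * S.lam i : ℝ)) • S.P i‖ ≤ 1 := by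
  refine S.norm_fc_le (fun x => Complex.exp (Complex.I * (y * x : ℝ))) zero_le_one fun x => ?_
  rw [mul_comm, Complex.norm_exp_ofReal_mul_I]

end SpectralRes

/-- Taylor expansion of `f(A + sB)` for hermitian operators on a finite-dimensional space. -/
lemma exists_taylor_finiteDimensional [CompleteSpace X] {f : ℝ → ℂ} (hf : ContDiff ℝ ∞ f) (μ : ℕ → ComplexMeasure ℝ)
    (hμ : ∀ n, IsFourierOf (weightedDeriv f n) (μ n)) {b : ℕ → ℝ}
    (hb : ∀ p, (μ p).variation.real Set.univ / p.factorial ≤ b p)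
    {A B : X →L[ℂ] X} (S : SpectralRes A) {r : ℝ} (hr : 0 ≤ r)
    (hB : ∀ x, ‖B x‖ ≤ r * ‖A x - Complex.I • x‖) :
    ∃ a : ℕ → X →L[ℂ] X, (∀ n, ‖a n‖ ≤ r ^ n * beta b n 0) ∧
      ∀ (s : ℝ) (S' : SpectralRes (A + (s : ℂ) • B)) (n : ℕ),
        ‖S'.fc f - ∑ k ∈ Finset.range n, (s : ℂ) ^ k • a k‖ ≤ |s| ^ n * (r ^ n * beta b n 0) := by
  have hb0 : ∀ p, 0 ≤ b p := fun p => le_trans (by positivity) (hb p)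
  have hbn : ∀ n, 0 ≤ beta b n 0 := fun n => beta_nonneg hb0 n 0
  -- `G` is `(A - i)⁻¹`, so `hB` says exactly that `K = B G` has norm at most `r`.
  set G := S.fc (fun x => (u x)⁻¹) with hG
  have hGu : (A - Complex.I • 1) * G = 1 := by
    rw [← S.fc_u, hG, ← S.fc_mul]
    simp [mul_inv_cancel₀ (u_ne_zero _), S.fc_const]
  set K := B * G with hK
  have hKr : ‖K‖ ≤ r := by
    refine ContinuousLinearMap.opNorm_le_bound _ hr fun x => ?_
    refine (hB (G x)).trans (le_of_eq ?_)
    have := congrArg (fun T : X →L[ℂ] X => T x) hGu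
    simp at this
    rw [this]
  have hKP : ∀ i, u (S.lam i) • (K * S.P i) = B * S.P i := by
    intro i
    have : G * S.P i = (u (S.lam i))⁻¹ • S.P i := by
      simp [hG, SpectralRes.fc, Finset.sum_mul, S.P_mul_P]
    rw [hK, mul_assoc, this, mul_smul_comm, smul_smul, mul_inv_cancel₀ (u_ne_zero _), one_smul]
  have hpow : ∀ n, ‖K‖ ^ n * beta b n 0 ≤ r ^ n * beta b n 0 := fun n =>
    mul_le_mul_of_nonneg_right (pow_le_pow_left₀ (norm_nonneg _) hKr n) (hbn n)
  refine ⟨taylorOp f K S.P S.lam S.P S.lam, fun n => ?_, fun s S' n => ?_⟩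
  · exact (norm_taylorOp_le hf μ hμ hb K S.P S.lam S.sum_P S.norm_exp_le S.P S.lam
      S.norm_exp_le n).trans (hpow n)
  -- The side condition is `P'_j (sB) P_i = P'_j ((A + sB) - A) P_i`, with both operators evaluated
  -- on their own eigenspaces.
  · have h1 := taylorOp_expansion hf K S.P S.lam S'.P S'.lam S.sum_P S'.sum_P (s : ℂ)
      (fun j i => by
        rw [mul_assoc, ← mul_smul_comm, hKP, ← mul_smul_comm, ← smul_mul_assoc]
        have h2 : ((s : ℂ) • B) * S.P i
            = (A + (s : ℂ) • B) * S.P i - (S.lam i : ℂ) • S.P i := by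
          rw [add_mul, S.mul_P, add_sub_cancel_left]
        rw [h2, mul_sub, ← mul_assoc, S'.P_mul, smul_mul_assoc, mul_smul_comm, ← sub_smul]
        push_cast
        rfl) n
    rw [SpectralRes.fc, h1, norm_smul, norm_pow, Complex.norm_real, Real.norm_eq_abs]
    refine mul_le_mul_of_nonneg_left ?_ (by positivity)
    exact (norm_taylorOp_le hf μ hμ hb K S.P S.lam S.sum_P S.norm_exp_le S'.P S'.lam
      S'.norm_exp_le n).trans (hpow n)

end Spectral

end RelTaylor
end

noncomputable section

namespace RelTaylor

/-! ### Functional calculus of a bounded resolvent -/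

/-- The circle of the points `(x - i)⁻¹`, `x` real, and `0`. -/
def circ : Set ℂ := Metric.sphere (Complex.I / 2) (1 / 2)

lemma isCompact_circ : IsCompact circ := isCompact_sphere _ _

instance : CompactSpace circ := isCompact_iff_compactSpace.1 isCompact_circ

lemma mem_circ_iff (w : ℂ) : w ∈ circ ↔ Complex.normSq w = w.im := by
  rw [circ, mem_sphere_iff_norm, ← sq_eq_sq₀ (norm_nonneg _) (by norm_num), ← Complex.normSq_eq_norm_sq,
    Complex.normSq_apply, Complex.normSq_apply]
  simp
  constructor <;> intro h <;> nlinarith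

lemma inv_u_mem_circ (x : ℝ) : (u x)⁻¹ ∈ circ := by
  have h : Complex.normSq (u x) ≠ 0 := fun h => u_ne_zero x (Complex.normSq_eq_zero.1 h)
  rw [mem_circ_iff, map_inv₀, Complex.inv_im]
  simp [u] at h ⊢

lemma inv_eq_u {w : ℂ} (hw : w ∈ circ) (h0 : w ≠ 0) : w⁻¹ = u (w⁻¹).re := by
  rw [mem_circ_iff] at hw
  have h : Complex.normSq w ≠ 0 := fun h => h0 (Complex.normSq_eq_zero.1 h)
  apply Complex.ext
  · simp [u]
  · rw [Complex.inv_im, hw]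
    rw [hw] at h
    simp [u, h]

/-- Transport of a function on the line to the circle. -/
def lift (f : ℝ → ℂ) (w : ℂ) : ℂ := if w = 0 then 0 else f (w⁻¹).re

lemma lift_inv_u (f : ℝ → ℂ) (x : ℝ) : lift f (u x)⁻¹ = f x := by
  rw [lift, if_neg (inv_ne_zero (u_ne_zero x)), inv_inv]
  simp [u]

/-- Continuous functions vanishing at infinity. -/
def IsC₀ (g : ℝ → ℂ) : Prop := Continuous g ∧ Tendsto g (cocompact ℝ) (𝓝 0)

/-- At `0`: a point of the circle tending to `0` is `(u x)⁻¹` with `|x| → ∞`, where `g` vanishes. -/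
lemma continuousOn_lift {g : ℝ → ℂ} (hg : IsC₀ g) : ContinuousOn (lift g) circ := by
  intro w hw
  by_cases h0 : w = 0
  · subst h0
    have hval : lift g 0 = 0 := by simp [lift]
    rw [ContinuousWithinAt, hval]
    have hlim : Tendsto (fun w : ℂ => (w⁻¹).re) (𝓝[circ \ {0}] 0) (cocompact ℝ) := by
      rw [← Metric.cobounded_eq_cocompact, ← tendsto_norm_atTop_iff_cobounded]
      have h1 : Tendsto (fun w : ℂ => ‖w⁻¹‖ - 1) (𝓝[circ \ {0}] 0) atTop := by
        refine tendsto_atTop_add_const_right _ _ ?_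
        refine (tendsto_norm_inv_nhdsNE_zero_atTop (α := ℂ)).mono_left ?_
        exact nhdsWithin_mono _ fun x hx => hx.2
      refine tendsto_atTop_mono' _ ?_ h1
      filter_upwards [self_mem_nhdsWithin] with w hw
      have := inv_eq_u hw.1 hw.2
      have h2 : ‖w⁻¹‖ ≤ ‖((w⁻¹).re : ℂ)‖ + ‖Complex.I‖ := by
        conv_lhs => rw [this]
        exact norm_sub_le _ _
      rw [Complex.norm_I, Complex.norm_real] at h2
      linarith
    have h3 : Tendsto (lift g) (𝓝[circ \ {0}] 0) (𝓝 0) := by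
      refine (hg.2.comp hlim).congr' ?_
      filter_upwards [self_mem_nhdsWithin] with w hw
      have : w ≠ 0 := hw.2
      simp [lift, this]
    have h4 : Tendsto (lift g) (pure (0 : ℂ)) (𝓝 0) := by
      have := tendsto_pure_nhds (lift g) (0 : ℂ)
      rwa [hval] at this
    refine (h3.sup h4).mono_left ?_
    have hc : circ ⊆ (circ \ {0}) ∪ {0} := by intro x hx; by_cases h : x = 0 <;> simp [h, hx]
    refine (nhdsWithin_mono _ hc).trans ?_
    rw [nhdsWithin_union, nhdsWithin_singleton]
  · have h1 : ContinuousAt (fun w : ℂ => g (w⁻¹).re) w :=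
      hg.1.continuousAt.comp (Complex.continuous_re.continuousAt.comp (continuousAt_inv₀ h0))
    refine (h1.congr ?_).continuousWithinAt
    filter_upwards [isOpen_ne.mem_nhds h0] with v hv
    have : v ≠ 0 := hv
    simp [lift, this]

lemma isC₀_of_support {g : ℝ → ℂ} (hg : Continuous g) {r : ℝ} (h : ∀ x, g x ≠ 0 → |x| ≤ r) :
    IsC₀ g := by
  refine ⟨hg, tendsto_const_nhds.congr' ?_⟩
  have := (isCompact_closedBall (0 : ℝ) r).compl_mem_cocompact
  filter_upwards [this] with x hx
  by_contra hne
  exact hx (by simpa using h x (Ne.symm hne))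

lemma IsC₀.mul {g h : ℝ → ℂ} (hg : IsC₀ g) (hh : IsC₀ h) : IsC₀ (fun x => g x * h x) :=
  ⟨hg.1.mul hh.1, by simpa using hg.2.mul hh.2⟩

lemma IsC₀.sum {ι : Type*} (s : Finset ι) {g : ι → ℝ → ℂ} (hg : ∀ i, IsC₀ (g i)) :
    IsC₀ (fun x => ∑ i ∈ s, g i x) :=
  ⟨continuous_finsetSum _ fun i _ => (hg i).1,
    by simpa using tendsto_finsetSum s fun i _ => (hg i).2⟩

lemma IsC₀.star {g : ℝ → ℂ} (hg : IsC₀ g) : IsC₀ (fun x => star (g x)) :=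
  ⟨hg.1.star, by simpa using hg.2.star⟩

lemma norm_u_sq (x : ℝ) : ‖u x‖ ^ 2 = x ^ 2 + 1 := by
  rw [← Complex.normSq_eq_norm_sq, Complex.normSq_apply]
  simp [u]
  ring

lemma one_le_norm_u (x : ℝ) : 1 ≤ ‖u x‖ := by
  have := norm_u_sq x
  nlinarith [norm_nonneg (u x), sq_nonneg x]

lemma abs_le_norm_u (x : ℝ) : |x| ≤ ‖u x‖ := by
  refine abs_le_of_sq_le_sq ?_ (norm_nonneg _)
  rw [norm_u_sq]; linarith

lemma isC₀_inv_u : IsC₀ (fun x => (u x)⁻¹) := by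
  refine ⟨contDiff_u.continuous.inv₀ u_ne_zero, ?_⟩
  have : Tendsto u (cocompact ℝ) (Bornology.cobounded ℂ) := by
    rw [← tendsto_norm_atTop_iff_cobounded]
    exact tendsto_atTop_mono (fun x => abs_le_norm_u x) (tendsto_norm_cocompact_atTop (E := ℝ))
  exact tendsto_inv₀_cobounded.comp this

/-! ### Operators with unitary Cayley transform -/

section Calculus

variable {E : Type*} [NormedAddCommGroup E] [InnerProductSpace ℂ E] [CompleteSpace E]

/-- `R` is the resolvent at `i` of a self-adjoint operator or relation: its Cayley transform is
unitary. -/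
def IsCayley (R : E →L[ℂ] E) : Prop := 1 + (2 * Complex.I) • R ∈ unitary (E →L[ℂ] E)

variable {R : E →L[ℂ] E}

lemma IsCayley.eq_smul (_ : IsCayley R) :
    R = (2 * Complex.I)⁻¹ • ((1 + (2 * Complex.I) • R) - 1) := by
  rw [add_sub_cancel_left, smul_smul, inv_mul_cancel₀ (by simp), one_smul]

lemma IsCayley.isStarNormal (hR : IsCayley R) : IsStarNormal R := by
  set U := 1 + (2 * Complex.I) • R with hU
  have h1 : star U * U = 1 := Unitary.star_mul_self_of_mem hR
  have h2 : U * star U = 1 := Unitary.mul_star_self_of_mem hR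
  have h3 : R = (2 * Complex.I)⁻¹ • (U - 1) := hR.eq_smul
  constructor
  rw [h3, commute_iff_eq, star_smul, star_sub, star_one, smul_mul_smul_comm, smul_mul_smul_comm, mul_comm (star _)]
  congr 1
  simp only [sub_mul, mul_sub, h1, h2, mul_one, one_mul]
  abel

/-- The affine map `w ↦ 1 + 2iw` carries `circ` onto the unit circle, which contains the spectrum of
a unitary. -/
lemma IsCayley.spectrum_subset (hR : IsCayley R) : spectrum ℂ R ⊆ circ := by
  intro w hw
  have h1 : 1 + (2 * Complex.I) * w ∈ spectrum ℂ (1 + (2 * Complex.I) • R) := by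
    have h2 : (2 * Complex.I) * w ∈ spectrum ℂ ((2 * Complex.I) • R) := by
      have := (spectrum.smul_mem_smul_iff (a := R) (s := w) (r := Units.mk0 (2 * Complex.I) (by simp))).2 hw
      simpa [Units.smul_def] using this
    have h3 := (spectrum.add_mem_add_iff (a := (2 * Complex.I) • R) (r := (2 * Complex.I) * w)
      (s := (1 : ℂ))).2 h2
    rw [map_one] at h3
    rwa [add_comm (1 : ℂ)]
  have h2 := spectrum.subset_circle_of_unitary hR h1
  rw [mem_sphere_zero_iff_norm, ← sq_eq_sq₀ (norm_nonneg _) (by norm_num),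
    ← Complex.normSq_eq_norm_sq, Complex.normSq_apply] at h2
  rw [mem_circ_iff, Complex.normSq_apply]
  simp at h2
  nlinarith

/-- The functional calculus on `C₀(ℝ)` attached to the resolvent `R`. -/
def fcalc (R : E →L[ℂ] E) (g : ℝ → ℂ) : E →L[ℂ] E := cfc (lift g) R

lemma IsCayley.continuousOn_lift (hR : IsCayley R) {g : ℝ → ℂ} (hg : IsC₀ g) :
    ContinuousOn (lift g) (spectrum ℂ R) :=
  (RelTaylor.continuousOn_lift hg).mono hR.spectrum_subset

lemma fcalc_mul (hR : IsCayley R) {g h : ℝ → ℂ} (hg : IsC₀ g) (hh : IsC₀ h) :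
    fcalc R (fun x => g x * h x) = fcalc R g * fcalc R h := by
  have := hR.isStarNormal
  rw [fcalc, fcalc, fcalc, ← cfc_mul _ _ R (hR.continuousOn_lift hg) (hR.continuousOn_lift hh)]
  congr 1
  ext w
  by_cases h0 : w = 0 <;> simp [lift, h0]

lemma fcalc_sub (hR : IsCayley R) {g h : ℝ → ℂ} (hg : IsC₀ g) (hh : IsC₀ h) :
    fcalc R (fun x => g x - h x) = fcalc R g - fcalc R h := by
  have := hR.isStarNormal
  rw [fcalc, fcalc, fcalc, ← cfc_sub _ _ R (hR.continuousOn_lift hg) (hR.continuousOn_lift hh)]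
  congr 1
  ext w
  by_cases h0 : w = 0 <;> simp [lift, h0]

lemma fcalc_const_mul (hR : IsCayley R) (c : ℂ) {g : ℝ → ℂ} (hg : IsC₀ g) :
    fcalc R (fun x => c * g x) = c • fcalc R g := by
  have := hR.isStarNormal
  rw [fcalc, fcalc, ← cfc_smul c _ R (hR.continuousOn_lift hg)]
  congr 1
  ext w
  by_cases h0 : w = 0 <;> simp [lift, h0]

lemma fcalc_sum (hR : IsCayley R) {ι : Type*} (s : Finset ι) {g : ι → ℝ → ℂ}
    (hg : ∀ i, IsC₀ (g i)) :
    fcalc R (fun x => ∑ i ∈ s, g i x) = ∑ i ∈ s, fcalc R (g i) := by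
  have := hR.isStarNormal
  simp only [fcalc]
  rw [← cfc_sum (fun i => lift (g i)) R s (fun i _ => hR.continuousOn_lift (hg i))]
  congr 1
  ext w
  by_cases h0 : w = 0 <;> simp [lift, h0]

lemma fcalc_star (g : ℝ → ℂ) : fcalc R (fun x => star (g x)) = star (fcalc R g) := by
  rw [fcalc, fcalc, ← cfc_star]
  congr 1
  ext w
  by_cases h0 : w = 0 <;> simp [lift, h0]

lemma norm_fcalc_le (hR : IsCayley R) {g : ℝ → ℂ} {M : ℝ} (hM0 : 0 ≤ M) (hM : ∀ x, ‖g x‖ ≤ M) :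
    ‖fcalc R g‖ ≤ M := by
  have := hR.isStarNormal
  refine norm_cfc_le hM0 fun w _ => ?_
  by_cases h0 : w = 0
  · simpa [lift, h0]
  · simpa [lift, h0] using hM _

lemma fcalc_inv_u (hR : IsCayley R) : fcalc R (fun x => (u x)⁻¹) = R := by
  have := hR.isStarNormal
  rw [fcalc]
  conv_rhs => rw [← cfc_id ℂ R]
  refine cfc_congr fun w hw => ?_
  by_cases h0 : w = 0
  · simp [lift, h0]
  · simp only [lift, h0, if_false, id]
    rw [← inv_eq_u (hR.spectrum_subset hw) h0, inv_inv]

lemma IsCayley.norm_le_one (hR : IsCayley R) : ‖R‖ ≤ 1 := by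
  have h := norm_fcalc_le hR (g := fun x => (u x)⁻¹) zero_le_one fun x => by
    rw [norm_inv]; exact inv_le_one_of_one_le₀ (one_le_norm_u x)
  rwa [fcalc_inv_u hR] at h

/-- The left side is the quadratic form of `∑ |α i|²` in the functional calculus. Treating the
family as one column operator avoids a factor counting the functions. -/
lemma sum_norm_sq_fcalc_le (hR : IsCayley R) {ι : Type*} [Fintype ι] {α : ι → ℝ → ℂ}
    (hα : ∀ i, IsC₀ (α i)) {M : ℝ} (hM : ∀ x, ∑ i, ‖α i x‖ ^ 2 ≤ M ^ 2) (ψ : E) :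
    ∑ i, ‖fcalc R (α i) ψ‖ ^ 2 ≤ M ^ 2 * ‖ψ‖ ^ 2 := by
  have h1 : ((∑ i, ‖fcalc R (α i) ψ‖ ^ 2 : ℝ) : ℂ)
      = inner ℂ ψ (fcalc R (fun x => ∑ i, star (α i x) * α i x) ψ) := by
    rw [fcalc_sum hR _ fun i => (hα i).star.mul (hα i), sum_apply, inner_sum]
    push_cast
    refine Finset.sum_congr rfl fun i _ => ?_
    rw [fcalc_mul hR (hα i).star (hα i), fcalc_star, mul_apply_eq_comp,
      ContinuousLinearMap.star_eq_adjoint, ContinuousLinearMap.adjoint_inner_right,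
      inner_self_eq_norm_sq_to_K]
    rfl
  have h2 : ‖fcalc R (fun x => ∑ i, star (α i x) * α i x)‖ ≤ M ^ 2 := by
    refine norm_fcalc_le hR (sq_nonneg _) fun x => ?_
    refine (norm_sum_le _ _).trans ((le_of_eq ?_).trans (hM x))
    refine Finset.sum_congr rfl fun i _ => ?_
    rw [norm_mul, norm_star, sq]
  have h3 : ∑ i, ‖fcalc R (α i) ψ‖ ^ 2
      = ‖inner ℂ ψ (fcalc R (fun x => ∑ i, star (α i x) * α i x) ψ)‖ := by
    rw [← h1, Complex.norm_real, Real.norm_of_nonneg (by positivity)]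
  rw [h3]
  refine (norm_inner_le_norm _ _).trans ?_
  have := ContinuousLinearMap.le_of_opNorm_le _ h2 ψ
  nlinarith [norm_nonneg ψ]

/-- The row operator is the adjoint of the column operator of the functions `star (α i)`, so it has
the same bound. -/
lemma norm_sq_sum_fcalc_le (hR : IsCayley R) {ι : Type*} [Fintype ι] {α : ι → ℝ → ℂ}
    (hα : ∀ i, IsC₀ (α i)) {M : ℝ} (hM : ∀ x, ∑ i, ‖α i x‖ ^ 2 ≤ M ^ 2) (ψ : ι → E) :
    ‖∑ i, fcalc R (α i) (ψ i)‖ ^ 2 ≤ M ^ 2 * ∑ i, ‖ψ i‖ ^ 2 := by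
  set v := ∑ i, fcalc R (α i) (ψ i) with hv
  have h1 : inner ℂ v v = ∑ i, inner ℂ (fcalc R (fun x => star (α i x)) v) (ψ i) := by
    conv_lhs => rw [hv, inner_sum]
    refine Finset.sum_congr rfl fun i _ => ?_
    rw [fcalc_star, ContinuousLinearMap.star_eq_adjoint, ContinuousLinearMap.adjoint_inner_left]
  have h2 : ‖v‖ ^ 2 ≤ ∑ i, ‖fcalc R (fun x => star (α i x)) v‖ * ‖ψ i‖ := by
    have : ‖v‖ ^ 2 = ‖inner ℂ v v‖ := by
      rw [inner_self_eq_norm_sq_to_K]; simp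
    rw [this, h1]
    exact (norm_sum_le _ _).trans (Finset.sum_le_sum fun i _ => norm_inner_le_norm _ _)
  have h3 := sum_norm_sq_fcalc_le hR (fun i => (hα i).star) (M := M) (by simpa using hM) v
  have h4 := Finset.sum_mul_sq_le_sq_mul_sq Finset.univ
    (fun i => ‖fcalc R (fun x => star (α i x)) v‖) (fun i => ‖ψ i‖)
  set Q := ∑ i, ‖ψ i‖ ^ 2
  have hQ : 0 ≤ Q := by positivity
  have h5 : (‖v‖ ^ 2) ^ 2 ≤ (M ^ 2 * ‖v‖ ^ 2) * Q :=
    (pow_le_pow_left₀ (by positivity) h2 2).trans (h4.trans (mul_le_mul_of_nonneg_right h3 hQ))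
  rcases eq_or_lt_of_le (sq_nonneg ‖v‖) with h0 | h0
  · rw [← h0]; positivity
  · have : ‖v‖ ^ 2 * ‖v‖ ^ 2 ≤ ‖v‖ ^ 2 * (M ^ 2 * Q) := by nlinarith
    exact le_of_mul_le_mul_left this h0

/-- Cutoffs of the functional calculus converge strongly to the identity. -/
lemma exists_norm_sub_fcalc_le (hR : IsCayley R) (hd : DenseRange R) (ξ : E) {ε : ℝ} (hε : 0 < ε) :
    ∃ N : ℝ, ∀ χ : ℝ → ℂ, IsC₀ χ → (∀ x, ‖χ x‖ ≤ 1) → (∀ x, ‖1 - χ x‖ ≤ 1) →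
      (∀ x, |x| ≤ N → χ x = 1) → ‖fcalc R χ ξ - ξ‖ ≤ ε := by
  obtain ⟨η, hη⟩ := hd.exists_dist_lt ξ (show 0 < ε / 4 by linarith)
  rw [dist_eq_norm] at hη
  -- Beyond `N` the resolvent has size at most `1/N`, which makes the error on `R η` at most `ε /
  -- 2`; replacing `ξ` by `R η` costs `ε / 4` twice.
  set N : ℝ := 2 * (‖η‖ + 1) / ε with hN
  have hN0 : 0 < N := by positivity
  refine ⟨N, fun χ hχ h1 h2 h3 => ?_⟩
  have h4 : ‖R - fcalc R χ * R‖ ≤ N⁻¹ := by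
    have e : R - fcalc R χ * R = fcalc R (fun x => (u x)⁻¹ - χ x * (u x)⁻¹) := by
      rw [fcalc_sub hR isC₀_inv_u (hχ.mul isC₀_inv_u), fcalc_mul hR hχ isC₀_inv_u, fcalc_inv_u hR]
    rw [e]
    refine norm_fcalc_le hR (by positivity) fun x => ?_
    have e2 : (u x)⁻¹ - χ x * (u x)⁻¹ = (1 - χ x) * (u x)⁻¹ := by ring
    rw [e2, norm_mul, norm_inv]
    by_cases hx : |x| ≤ N
    · rw [h3 x hx]; simp; positivity
    · have h5 : N ≤ ‖u x‖ := (le_of_not_ge hx).trans (abs_le_norm_u x)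
      have h6 : ‖u x‖⁻¹ ≤ N⁻¹ := inv_anti₀ hN0 h5
      calc _ ≤ 1 * ‖u x‖⁻¹ := mul_le_mul_of_nonneg_right (h2 x) (by positivity)
        _ ≤ _ := by rwa [one_mul]
  have h5 : ‖R η - fcalc R χ (R η)‖ ≤ ε / 2 := by
    have := ContinuousLinearMap.le_of_opNorm_le _ h4 η
    refine this.trans ?_
    rw [hN, inv_div]
    rw [div_mul_eq_mul_div, div_le_div_iff₀ (by positivity) (by norm_num)]
    nlinarith [norm_nonneg η]
  have h6 : ‖fcalc R χ (ξ - R η)‖ ≤ ε / 4 := by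
    refine (ContinuousLinearMap.le_of_opNorm_le _ (norm_fcalc_le hR zero_le_one h1) _).trans ?_
    rw [one_mul]; exact hη.le
  have e : fcalc R χ ξ - ξ = fcalc R χ (ξ - R η) - (ξ - R η) - (R η - fcalc R χ (R η)) := by
    rw [map_sub]; abel
  rw [e]
  refine (norm_sub_le _ _).trans ?_
  refine (add_le_add (norm_sub_le _ _) h5).trans ?_
  linarith [hη.le]

end Calculus

end RelTaylor
end

noncomputable section

namespace RelTaylor

/-! ### Finite-dimensional models -/

/-- Squares of continuous functions with small supports that add up to one on a large interval. -/
lemma exists_partition {δ : ℝ} (hδ : 0 < δ) (N : ℝ) :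
    ∃ (m : ℕ) (φ : Fin m → ℝ → ℝ) (lam : Fin m → ℝ), (∀ j, Continuous (φ j)) ∧
      (∀ j x, φ j x ≠ 0 → |x - lam j| ≤ δ) ∧ (∀ x, ∑ j, φ j x ^ 2 ≤ 1) ∧
      (∀ x, |x| ≤ N → ∑ j, φ j x ^ 2 = 1) := by
  obtain ⟨k, hk⟩ := exists_nat_ge (N / δ + 1)
  have hk' : N ≤ (k - 1) * δ := by
    have : N / δ ≤ k - 1 := by linarith
    rwa [div_le_iff₀ hδ] at this
  -- `c t` is a ramp rising from `0` at `tδ` to `1` at `(t + 1)δ`. Differences of consecutive ramps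
  -- are tents of half-width `δ` that telescope; the `φ j` are their square roots.
  let c : ℝ → ℝ → ℝ := fun t x => max 0 (min 1 (x / δ - t))
  have hc0 : ∀ t x, 0 ≤ c t x := fun t x => le_max_left _ _
  have hc1 : ∀ t x, c t x ≤ 1 := fun t x => max_le zero_le_one (min_le_left _ _)
  have hmono : ∀ t x, 0 ≤ c t x - c (t + 1) x := by
    intro t x
    have : c (t + 1) x ≤ c t x := max_le_max le_rfl (min_le_min le_rfl (by linarith))
    linarith
  let d : ℕ → ℝ → ℝ := fun j => c ((j : ℝ) - k)
  have hd : ∀ j x, d j x - d (j + 1) x = c ((j : ℝ) - k) x - c ((j : ℝ) - k + 1) x := by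
    intro j x
    simp only [d]
    push_cast
    rw [show (j : ℝ) + 1 - k = j - k + 1 by ring]
  have hsum : ∀ x, ∑ j : Fin (2 * k), Real.sqrt (d j x - d (j + 1) x) ^ 2
      = c (-k) x - c k x := by
    intro x
    rw [Fin.sum_univ_eq_sum_range (fun j => Real.sqrt (d j x - d (j + 1) x) ^ 2) (2 * k)]
    have : ∀ j, Real.sqrt (d j x - d (j + 1) x) ^ 2 = d j x - d (j + 1) x := fun j =>
      Real.sq_sqrt (by rw [hd]; exact hmono _ _)
    simp only [this]
    rw [Finset.sum_range_sub' (fun j => d j x)]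
    simp only [d]
    push_cast
    rw [show (2 : ℝ) * k - k = k by ring, show (0 : ℝ) - k = -k by ring]
  refine ⟨2 * k, fun j x => Real.sqrt (d j x - d (j + 1) x), fun j => (j - k + 1) * δ,
    fun j => by simp only [d, c]; fun_prop, fun j x hne => ?_, fun x => ?_, fun x hx => ?_⟩
  · simp only [hd] at hne
    by_contra hlt
    apply hne
    rw [Real.sqrt_eq_zero (hmono _ _)]
    simp only [c]
    rcases lt_abs.1 (not_le.1 hlt) with h | h
    · have h1 : (j : ℝ) - k + 2 < x / δ := by
        rw [lt_div_iff₀ hδ]; nlinarith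
      rw [min_eq_left (by linarith), min_eq_left (by linarith), sub_self]
    · have h1 : x / δ < (j : ℝ) - k := by
        rw [div_lt_iff₀ hδ]; nlinarith
      rw [max_eq_left, max_eq_left, sub_self]
      · exact (min_le_right _ _).trans (by linarith)
      · exact (min_le_right _ _).trans (by linarith)
  · rw [hsum]; linarith [hc0 k x, hc1 (-k) x]
  · rw [hsum]
    obtain ⟨h1, h2⟩ := abs_le.1 hx
    have h3 : x / δ ≤ k - 1 := by rw [div_le_iff₀ hδ]; linarith
    have h4 : -((k : ℝ) - 1) ≤ x / δ := by rw [le_div_iff₀ hδ]; linarith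
    have h5 : c (-k) x = 1 := by
      simp only [c]
      rw [min_eq_left (by linarith), max_eq_right zero_le_one]
    have h6 : c k x = 0 := by
      simp only [c]
      exact max_eq_left ((min_le_right _ _).trans (by linarith))
    rw [h5, h6, sub_zero]

-- Compression to finite-dimensional spaces

universe v

/-- A finite-dimensional space with a contraction `J` into it and hermitian operators `A`, `B`. -/
structure FinModel (E : Type v) [NormedAddCommGroup E] [InnerProductSpace ℂ E] where
  /-- the space -/
  X : Type v
  [normed : NormedAddCommGroup X]
  [inner : InnerProductSpace ℂ X]
  [finite : FiniteDimensional ℂ X]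
  /-- the contraction -/
  J : E →L[ℂ] X
  /-- the model of the unperturbed operator -/
  A : X →L[ℂ] X
  /-- the model of the perturbation -/
  B : X →L[ℂ] X
  norm_J_le : ∀ ψ, ‖J ψ‖ ≤ ‖ψ‖
  symm_A : ∀ x y, Inner.inner ℂ (A x) y = Inner.inner ℂ x (A y)
  symm_B : ∀ x y, Inner.inner ℂ (B x) y = Inner.inner ℂ x (B y)

attribute [instance] FinModel.normed FinModel.inner FinModel.finite

variable {E : Type v} [NormedAddCommGroup E] [InnerProductSpace ℂ E] [CompleteSpace E]

/-- The model approximates the operator with resolvent `R` at `i` and its perturbation `V` with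
`K = V R`, up to `δ`, on the vectors `R ξ`, `ξ ∈ Ξ`. -/
structure FinModel.Approximates (m : FinModel E) (R K : E →L[ℂ] E) (δ : ℝ) (Ξ : Finset E) :
    Prop where
  norm_B_le : ∀ x, ‖m.B x‖ ≤ ‖K‖ * (1 + δ) * ‖m.A x - Complex.I • x‖
  norm_A_sub_le : ∀ ξ ∈ Ξ, ‖m.A (m.J (R ξ)) - Complex.I • m.J (R ξ) - m.J ξ‖ ≤ δ * ‖R ξ‖
  norm_B_sub_le : ∀ ξ ∈ Ξ, ‖m.B (m.J (R ξ)) - m.J (K ξ)‖ ≤ ‖K‖ * δ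
  norm_inner_sub_le : ∀ ξ ∈ Ξ, ∀ η,
    ‖Inner.inner ℂ (m.J η) (m.J (R ξ)) - Inner.inner ℂ η (R ξ)‖ ≤ ‖η‖ * δ

/-- With a quadratic partition `φ j` of small supports near `lam j`, put `J ψ = (P_F φ_j(H) ψ)_j` in
`Fⁿ` and let `A` multiply the `j`-th component by `lam j`. On the support of `φ j` the function `u`
differs from `u (lam j)` by at most `δ`, and row and column estimates make the errors independent of
`n`. The finite-dimensional `F` contains all `φ_j(H) R ξ`, so the projection is invisible on the
vectors that matter. -/
lemma exists_finModel {R K : E →L[ℂ] E} (hR : IsCayley R) (hd : DenseRange R)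
    (hRK : ∀ x y, inner ℂ (K x) (R y) = inner ℂ (R x) (K y)) {δ : ℝ} (hδ : 0 < δ) (Ξ : Finset E) :
    ∃ m : FinModel E, m.Approximates R K δ Ξ := by
  classical
  choose N₀ hN₀ using fun ξ => exists_norm_sub_fcalc_le hR hd ξ hδ
  obtain ⟨N, hN⟩ : ∃ N, ∀ ξ ∈ Ξ, N₀ ξ ≤ N := (Ξ.image N₀).exists_le.imp fun N h ξ hξ =>
    h _ (Finset.mem_image_of_mem _ hξ)
  obtain ⟨n, φ, lam, hφc, hφs, hφ1, hφN⟩ := exists_partition hδ N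
  have hsupp : ∀ j x, (φ j x : ℂ) ≠ 0 → |x| ≤ |lam j| + δ := fun j x h => by
    have := hφs j x (by exact_mod_cast h)
    have h2 := abs_sub_abs_le_abs_sub x (lam j)
    linarith
  have hcφ : ∀ j, Continuous fun x => (φ j x : ℂ) := fun j => Complex.continuous_ofReal.comp (hφc j)
  have hφ0 : ∀ j, IsC₀ fun x => (φ j x : ℂ) := fun j => isC₀_of_support (hcφ j) (hsupp j)
  have hmulφ : ∀ (v : ℝ → ℂ), Continuous v → ∀ j, IsC₀ fun x => v x * (φ j x : ℂ) := fun v hv j =>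
    isC₀_of_support (hv.mul (hcφ j)) fun x h => hsupp j x (right_ne_zero_of_mul h)
  have huφ := hmulφ u contDiff_u.continuous
  set Φ : Fin n → E →L[ℂ] E := fun j => fcalc R fun x => (φ j x : ℂ) with hΦ
  set Ψ : Fin n → E →L[ℂ] E := fun j => fcalc R fun x => u x * (φ j x : ℂ) with hΨ
  have hRΨ : ∀ j, R * Ψ j = Φ j := fun j => by
    simp only [hΨ, hΦ]
    nth_rewrite 1 [← fcalc_inv_u hR]
    rw [← fcalc_mul hR isC₀_inv_u (huφ j)]
    congr 1
    ext x
    rw [← mul_assoc, inv_mul_cancel₀ (u_ne_zero x), one_mul]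
  have hΨR : ∀ j, Ψ j * R = Φ j := fun j => by
    simp only [hΨ, hΦ]
    nth_rewrite 2 [← fcalc_inv_u hR]
    rw [← fcalc_mul hR (huφ j) isC₀_inv_u]
    congr 1
    ext x
    rw [mul_right_comm, mul_inv_cancel₀ (u_ne_zero x), one_mul]
  have hΦs : ∀ j x y, inner ℂ (Φ j x) y = inner ℂ x (Φ j y) := fun j x y => by
    have : star (Φ j) = Φ j := by
      simp only [hΦ]
      rw [← fcalc_star]
      congr 1
      ext x
      simp
    conv_rhs => rw [← this, ContinuousLinearMap.star_eq_adjoint]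
    rw [ContinuousLinearMap.adjoint_inner_right]
  set F : Submodule ℂ E := Submodule.span ℂ
    ((Finset.univ ×ˢ Ξ).image fun p : Fin n × E => Φ p.1 (R p.2) : Finset E) with hF
  have hFd : FiniteDimensional ℂ F := FiniteDimensional.span_finset ℂ _
  have hFmem : ∀ j, ∀ ξ ∈ Ξ, Φ j (R ξ) ∈ F := fun j ξ hξ => Submodule.subset_span <| by
    simp only [Finset.coe_image, Set.mem_image]
    exact ⟨(j, ξ), by simpa using hξ, rfl⟩
  let X := PiLp 2 fun _ : Fin n => F
  let pr : Fin n → X →L[ℂ] F := fun j => PiLp.proj 2 (fun _ : Fin n => F) j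
  let emb : (E →L[ℂ] (Fin n → F)) → (E →L[ℂ] X) := fun T =>
    ((PiLp.continuousLinearEquiv 2 ℂ fun _ : Fin n => F).symm : (Fin n → F) →L[ℂ] X) ∘L T
  let J : E →L[ℂ] X := emb (ContinuousLinearMap.pi fun j => F.orthogonalProjectionOnto ∘L Φ j)
  let A : X →L[ℂ] X := ((PiLp.continuousLinearEquiv 2 ℂ fun _ : Fin n => F).symm :
    (Fin n → F) →L[ℂ] X) ∘L ContinuousLinearMap.pi fun j => (lam j : ℂ) • pr j
  let Jt : X →L[ℂ] E := ∑ j, Φ j ∘L F.subtypeL ∘L pr j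
  let Ψt : X →L[ℂ] E := ∑ j, Ψ j ∘L F.subtypeL ∘L pr j
  have hJ : ∀ ψ j, J ψ j = F.orthogonalProjectionOnto (Φ j ψ) := fun ψ j => rfl
  have hA : ∀ (x : X) j, A x j = (lam j : ℂ) • x j := fun x j => rfl
  have hJt : ∀ x : X, Jt x = ∑ j, Φ j (x j : E) := fun x => by
    simp only [Jt, sum_apply]; rfl
  have hΨt : ∀ x : X, Ψt x = ∑ j, Ψ j (x j : E) := fun x => by
    simp only [Ψt, sum_apply]; rfl
  have hRΨt : ∀ x : X, R (Ψt x) = Jt x := fun x => by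
    rw [hJt, hΨt, map_sum]
    exact Finset.sum_congr rfl fun j _ => by rw [← hRΨ]; rfl
  have hadj : ∀ (x : X) (ψ : E), inner ℂ x (J ψ) = inner ℂ (Jt x) ψ := fun x ψ => by
    rw [hJt, sum_inner, PiLp.inner_apply]
    refine Finset.sum_congr rfl fun j _ => ?_
    rw [hJ, hΦs, Submodule.inner_orthogonalProjectionOnto_eq_of_mem_left]
  have hadj' : ∀ (x : X) (ψ : E), inner ℂ (J ψ) x = inner ℂ ψ (Jt x) := fun x ψ => by
    rw [← inner_conj_symm, hadj, inner_conj_symm]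
  have hproj : ∀ v : E, ‖F.orthogonalProjectionOnto v‖ ≤ ‖v‖ := fun v => by
    exact F.norm_orthogonalProjectionOnto_apply_le v
  have hnormX : ∀ x : X, ‖x‖ ^ 2 = ∑ j, ‖x j‖ ^ 2 := fun x => PiLp.norm_sq_eq_of_L2 _ x
  have hcol : ∀ (α : Fin n → ℝ → ℂ) (M : ℝ), 0 ≤ M → (∀ j, IsC₀ (α j)) →
      (∀ x, ∑ i, ‖α i x‖ ^ 2 ≤ M ^ 2) → ∀ (ψ : E) (x : X),
      (∀ j, x j = F.orthogonalProjectionOnto (fcalc R (α j) ψ)) → ‖x‖ ≤ M * ‖ψ‖ := by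
    intro α M hM0 hα hM ψ x hx
    refine le_of_sq_le_sq ?_ (by positivity)
    rw [hnormX, mul_pow]
    refine le_trans (Finset.sum_le_sum fun j _ => ?_) (sum_norm_sq_fcalc_le hR hα hM ψ)
    rw [hx]
    exact pow_le_pow_left₀ (norm_nonneg _) (hproj _) 2
  have hJnorm : ∀ ψ, ‖J ψ‖ ≤ ‖ψ‖ := fun ψ => by
    have := hcol (fun j x => (φ j x : ℂ)) 1 zero_le_one hφ0 (fun x => by simpa using hφ1 x) ψ (J ψ)
      (fun j => rfl)
    simpa using this
  -- `Jt` is the adjoint of `J` and `R Ψt = Jt`, so formally `K Ψt = V Jt` and `B = J V Jt`; hence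
  -- its symmetry.
  let B : X →L[ℂ] X := J ∘L K ∘L Ψt
  have hB : ∀ x, B x = J (K (Ψt x)) := fun x => rfl
  let m : FinModel E :=
    { X := X
      J := J
      A := A
      B := B
      norm_J_le := hJnorm
      symm_A := fun x y => by
        rw [PiLp.inner_apply, PiLp.inner_apply]
        refine Finset.sum_congr rfl fun j _ => ?_
        rw [hA, hA, inner_smul_left, inner_smul_right, Complex.conj_ofReal]
      symm_B := fun x y => by
        rw [hB, hB, hadj, hadj', ← hRΨt, ← hRΨt, hRK] }
  -- the cutoff
  set χ : ℝ → ℂ := fun x => ∑ j, (φ j x : ℂ) * (φ j x : ℂ) with hχ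
  have hχr : ∀ x, χ x = ((∑ j, φ j x ^ 2 : ℝ) : ℂ) := fun x => by
    simp only [hχ]; push_cast; exact Finset.sum_congr rfl fun j _ => by ring
  have hχ0 : IsC₀ χ := IsC₀.sum _ fun j => (hφ0 j).mul (hφ0 j)
  have hsn : ∀ x, 0 ≤ ∑ j, φ j x ^ 2 := fun x => by positivity
  have hχξ : ∀ ξ ∈ Ξ, ‖fcalc R χ ξ - ξ‖ ≤ δ := fun ξ hξ => by
    refine hN₀ ξ χ hχ0 (fun x => ?_) (fun x => ?_) fun x hx => ?_
    · rw [hχr, Complex.norm_real, Real.norm_of_nonneg (hsn x)]; exact hφ1 x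
    · rw [hχr, ← Complex.ofReal_one, ← Complex.ofReal_sub, Complex.norm_real,
        Real.norm_of_nonneg (by linarith [hφ1 x])]
      linarith [hsn x]
    · rw [hχr, hφN x (hx.trans (hN ξ hξ)), Complex.ofReal_one]
  have hΨJ : ∀ ξ ∈ Ξ, Ψt (J (R ξ)) = fcalc R χ ξ := fun ξ hξ => by
    rw [hΨt, hχ, fcalc_sum hR _ fun j => (hφ0 j).mul (hφ0 j), sum_apply]
    refine Finset.sum_congr rfl fun j _ => ?_
    have h1 : (F.orthogonalProjectionOnto (Φ j (R ξ)) : E) = Φ j (R ξ) :=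
      Submodule.starProjection_eq_self_iff.2 (hFmem j ξ hξ)
    rw [hJ, h1, fcalc_mul hR (hφ0 j) (hφ0 j)]
    change (Ψ j * (Φ j * R)) ξ = (Φ j * Φ j) ξ
    have h2 : Ψ j * (Φ j * R) = Φ j * Φ j := by
      calc Ψ j * (Φ j * R) = Ψ j * (R * Ψ j * R) := by rw [hRΨ]
        _ = Ψ j * R * (Ψ j * R) := by simp only [mul_assoc]
        _ = Φ j * Φ j := by rw [hΨR]
    rw [h2]
  refine ⟨m, ?_, fun ξ _ => ?_, fun ξ hξ => ?_, fun ξ hξ η => ?_⟩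
  · intro x
    change ‖B x‖ ≤ _ * ‖A x - Complex.I • x‖
    rw [hB, mul_assoc]
    refine (hJnorm _).trans (K.le_opNorm_of_le ?_)
    -- Dividing by `u (lam j)` makes `(A - i) x` appear; the remaining quotient `u t / u (lam j)` is
    -- at most `1 + δ` on the support, as `|u| ≥ 1`.
    have h1 : Ψt x = ∑ j, fcalc R (fun t => (u (lam j))⁻¹ * u t * (φ j t : ℂ))
        (u (lam j) • (x j : E)) := by
      rw [hΨt]
      refine Finset.sum_congr rfl fun j _ => ?_
      simp only [mul_assoc]
      rw [fcalc_const_mul hR _ (huφ j), smul_apply, map_smul, smul_smul,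
        inv_mul_cancel₀ (u_ne_zero _), one_smul]
    have h2 : ∀ j, (A x - Complex.I • x) j = u (lam j) • x j := fun j => by
      change A x j - Complex.I • x j = _
      rw [hA, ← sub_smul]
      rfl
    refine le_of_sq_le_sq ?_ (by positivity)
    rw [h1, mul_pow, hnormX]
    simp only [h2]
    refine norm_sq_sum_fcalc_le hR (fun j => hmulφ (fun t => (u (lam j))⁻¹ * u t)
      (continuous_const.mul contDiff_u.continuous) j) (fun t => ?_) _
    calc ∑ j, ‖(u (lam j))⁻¹ * u t * (φ j t : ℂ)‖ ^ 2
        ≤ ∑ j, (1 + δ) ^ 2 * φ j t ^ 2 := Finset.sum_le_sum fun j _ => ?_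
      _ ≤ (1 + δ) ^ 2 := by
        rw [← Finset.mul_sum]
        exact mul_le_of_le_one_right (by positivity) (hφ1 t)
    by_cases h0 : φ j t = 0
    · simp [h0]
    · rw [norm_mul, mul_pow, Complex.norm_real, Real.norm_eq_abs, sq_abs]
      refine mul_le_mul_of_nonneg_right (pow_le_pow_left₀ (norm_nonneg _) ?_ 2) (sq_nonneg _)
      have h3 : ‖u t‖ ≤ ‖u (lam j)‖ + δ := by
        have : u t = u (lam j) + ((t - lam j : ℝ) : ℂ) := by simp [u]
        rw [this]
        refine (norm_add_le _ _).trans (add_le_add le_rfl ?_)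
        rw [Complex.norm_real, Real.norm_eq_abs]
        exact hφs j t h0
      have h4 := one_le_norm_u (lam j)
      rw [norm_mul, norm_inv, inv_mul_le_iff₀ (by linarith)]
      nlinarith
  · change ‖A (J (R ξ)) - Complex.I • J (R ξ) - J ξ‖ ≤ _
    refine hcol (fun j t => (u (lam j) - u t) * (φ j t : ℂ)) δ hδ.le
      (fun j => hmulφ _ (continuous_const.sub contDiff_u.continuous) j) (fun t => ?_) _ _
      fun j => ?_
    · calc ∑ j, ‖(u (lam j) - u t) * (φ j t : ℂ)‖ ^ 2
          ≤ ∑ j, δ ^ 2 * φ j t ^ 2 := Finset.sum_le_sum fun j _ => ?_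
        _ ≤ δ ^ 2 := by
          rw [← Finset.mul_sum]
          exact mul_le_of_le_one_right (by positivity) (hφ1 t)
      by_cases h0 : φ j t = 0
      · simp [h0]
      · rw [norm_mul, mul_pow, Complex.norm_real, Real.norm_eq_abs, sq_abs]
        refine mul_le_mul_of_nonneg_right (pow_le_pow_left₀ (norm_nonneg _) ?_ 2) (sq_nonneg _)
        have : u (lam j) - u t = ((lam j - t : ℝ) : ℂ) := by simp [u]
        rw [this, Complex.norm_real, Real.norm_eq_abs, abs_sub_comm]
        exact hφs j t h0
    · change A (J (R ξ)) j - Complex.I • J (R ξ) j - J ξ j = _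
      have h1 : fcalc R (fun t => (u (lam j) - u t) * (φ j t : ℂ)) = u (lam j) • Φ j - Ψ j := by
        simp only [sub_mul]
        rw [fcalc_sub hR (hmulφ (fun _ => u (lam j)) continuous_const j) (huφ j),
          fcalc_const_mul hR _ (hφ0 j)]
      have h2 : Φ j ξ = Ψ j (R ξ) := by rw [← hΨR]; rfl
      rw [h1, hA, ← sub_smul, hJ, hJ, h2, sub_apply, smul_apply, map_sub, map_smul]
      rfl
  · change ‖B (J (R ξ)) - J (K ξ)‖ ≤ _
    rw [hB, hΨJ ξ hξ, ← map_sub, ← map_sub]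
    refine (hJnorm _).trans (K.le_opNorm_of_le (hχξ ξ hξ))
  · change ‖inner ℂ (J η) (J (R ξ)) - inner ℂ η (R ξ)‖ ≤ _
    rw [hadj', ← hRΨt, hΨJ ξ hξ, ← inner_sub_right, ← map_sub]
    refine (norm_inner_le_norm _ _).trans (mul_le_mul_of_nonneg_left ?_ (norm_nonneg _))
    refine (R.le_of_opNorm_le hR.norm_le_one _).trans ?_
    rw [one_mul]
    exact hχξ ξ hξ

end RelTaylor
end

noncomputable section

namespace RelTaylor

universe v

/-! ### Passage to the limit -/

section WeakLimit

variable {E : Type v} [NormedAddCommGroup E] [InnerProductSpace ℂ E]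

lemma norm_le_of_weak_limit {I : Type*} {l : Filter I} [l.NeBot] {T : I → E →L[ℂ] E}
    {L : E →L[ℂ] E}
    (hT : ∀ ψ φ, Tendsto (fun i => inner ℂ (T i ψ) φ) l (𝓝 (inner ℂ (L ψ) φ)))
    {c : I → ℝ} {d : ℝ} (hc : ∀ i, ‖T i‖ ≤ c i) (hd : Tendsto c l (𝓝 d)) : ‖L‖ ≤ d := by
  have hd0 : 0 ≤ d := ge_of_tendsto' hd fun i => (norm_nonneg _).trans (hc i)
  refine ContinuousLinearMap.opNorm_le_bound _ hd0 fun ψ => ?_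
  have h1 : ‖inner ℂ (L ψ) (L ψ)‖ ≤ d * ‖ψ‖ * ‖L ψ‖ := by
    refine le_of_tendsto_of_tendsto' (hT ψ (L ψ)).norm
      ((hd.mul_const ‖ψ‖).mul_const ‖L ψ‖) fun i => ?_
    exact (norm_inner_le_norm _ _).trans
      (mul_le_mul_of_nonneg_right ((T i).le_of_opNorm_le (hc i) ψ) (norm_nonneg _))
  have h2 : ‖inner ℂ (L ψ) (L ψ)‖ = ‖L ψ‖ * ‖L ψ‖ := by
    rw [inner_self_eq_norm_sq_to_K]; simp [sq]
  rw [h2] at h1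
  rcases eq_or_lt_of_le (norm_nonneg (L ψ)) with h0 | h0
  · rw [← h0]; positivity
  · exact le_of_mul_le_mul_right h1 h0

variable [CompleteSpace E]

/-- Bounded families of operators have weak limits along ultrafilters. -/
lemma exists_weak_limit {I : Type*} (𝒰 : Ultrafilter I) (T : I → E →L[ℂ] E) {M : ℝ}
    (hM : ∀ i, ‖T i‖ ≤ M) :
    ∃ L : E →L[ℂ] E, ∀ ψ φ, Tendsto (fun i => inner ℂ (T i ψ) φ) 𝒰 (𝓝 (inner ℂ (L ψ) φ)) := by
  have hb : ∀ i ψ φ, ‖inner ℂ (T i ψ) φ‖ ≤ M * ‖ψ‖ * ‖φ‖ := fun i ψ φ =>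
    (norm_inner_le_norm _ _).trans
      (mul_le_mul_of_nonneg_right ((T i).le_of_opNorm_le (hM i) ψ) (norm_nonneg _))
  have hex : ∀ ψ φ, ∃ z : ℂ, ‖z‖ ≤ M * ‖ψ‖ * ‖φ‖ ∧
      Tendsto (fun i => inner ℂ (T i ψ) φ) 𝒰 (𝓝 z) := by
    intro ψ φ
    obtain ⟨z, hz, hz'⟩ := (isCompact_closedBall (0 : ℂ) (M * ‖ψ‖ * ‖φ‖)).ultrafilter_le_nhds'
      (𝒰.map fun i => inner ℂ (T i ψ) φ) (by
        rw [Ultrafilter.mem_map]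
        exact Filter.univ_mem' fun i => by simpa using hb i ψ φ)
    exact ⟨z, by simpa using hz, hz'⟩
  choose q hq hqt using hex
  -- Uniqueness of limits makes `q` sesquilinear, and a bounded sesquilinear form comes from an
  -- operator.
  let Q : E →ₗ⋆[ℂ] E →ₗ[ℂ] ℂ := LinearMap.mk₂'ₛₗ (starRingEnd ℂ) (RingHom.id ℂ) q
    (fun x y z => tendsto_nhds_unique (hqt _ _)
      (((hqt x z).add (hqt y z)).congr fun i => by rw [map_add, inner_add_left]))
    (fun c x y => tendsto_nhds_unique (hqt _ _)
      (((hqt x y).const_mul (starRingEnd ℂ c)).congr fun i => by rw [map_smul, inner_smul_left]))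
    (fun x y z => tendsto_nhds_unique (hqt _ _)
      (((hqt x y).add (hqt x z)).congr fun i => by rw [inner_add_right]))
    (fun c x y => tendsto_nhds_unique (hqt _ _)
      (((hqt x y).const_mul c).congr fun i => by rw [inner_smul_right]))
  let Qc : E →L⋆[ℂ] E →L[ℂ] ℂ := LinearMap.mkContinuous₂ Q M hq
  refine ⟨InnerProductSpace.continuousLinearMapOfBilin Qc, fun ψ φ => ?_⟩
  rw [InnerProductSpace.continuousLinearMapOfBilin_apply]
  exact hqt ψ φ

end WeakLimit

/-! ### Convergence of the models -/

section Models

variable {E : Type v} [NormedAddCommGroup E] [InnerProductSpace ℂ E] [CompleteSpace E]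

/-- The spectral resolution of `A + sB` in a model. -/
def FinModel.res (m : FinModel E) (s : ℝ) : SpectralRes (m.A + (s : ℂ) • m.B) :=
  spectralRes _ fun x y => by
    have hA : Inner.inner ℂ (m.A x) y = Inner.inner ℂ x (m.A y) := m.symm_A x y
    have hB : Inner.inner ℂ (m.B x) y = Inner.inner ℂ x (m.B y) := m.symm_B x y
    simp only [ContinuousLinearMap.coe_coe, add_apply, smul_apply, inner_add_left,
      inner_add_right, inner_smul_left, inner_smul_right, Complex.conj_ofReal, hA, hB]

/-- `S` is the resolvent at `i` of `H + sV`, where `R = (H - i)⁻¹` and `K = V R`. -/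
structure IsPerturbed (R K : E →L[ℂ] E) (s : ℝ) (S : E →L[ℂ] E) : Prop where
  isCayley : IsCayley S
  exists_eq : ∀ ψ, ∃ ξ, S ψ = R ξ ∧ ψ = ξ + (s : ℂ) • K ξ

/-- Unitarity of `1 + 2iS` is the resolvent identity `S - S* = 2i S S*`. It puts the range of `S*`
inside that of `S`, so `IsPerturbed.exists_eq` also serves the adjoint. -/
lemma IsCayley.star_eq {S : E →L[ℂ] E} (hS : IsCayley S) (ψ : E) :
    star S ψ = S (ψ - (2 * Complex.I) • star S ψ) := by
  have h1 : (1 + (2 * Complex.I) • S) * star (1 + (2 * Complex.I) • S) = 1 :=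
    Unitary.mul_star_self_of_mem hS
  have h2 : star (1 + (2 * Complex.I) • S) = 1 - (2 * Complex.I) • star S := by
    rw [star_add, star_one, star_smul]
    simp [sub_eq_add_neg]
  rw [h2] at h1
  have h3 : (2 * Complex.I) • (S - star S - (2 * Complex.I) • (S * star S)) = 0 := by
    have : (1 + (2 * Complex.I) • S) * (1 - (2 * Complex.I) • star S) - 1
        = (2 * Complex.I) • (S - star S - (2 * Complex.I) • (S * star S)) := by
      simp only [add_mul, mul_sub, one_mul, mul_one, smul_sub, smul_mul_smul_comm, smul_smul]
      abel
    rw [← this, h1, sub_self]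
  have h4 := (smul_eq_zero.1 h3).resolve_left (by simp)
  have h5 := congrArg (fun T : E →L[ℂ] E => T ψ) h4
  simp at h5
  rw [map_sub, map_smul]
  rw [sub_sub, sub_eq_zero] at h5
  rw [h5]
  abel

variable {I : Type*} {l : Filter I} {R K : E →L[ℂ] E} {s : ℝ} {S : E →L[ℂ] E}
  {m : I → FinModel E}

/-- The functional calculi of approximating models converge to the one of the operator. -/
lemma tendsto_fc_circ (hS : IsPerturbed R K s S)
    (hm : ∀ ξ, Tendsto (fun i => ‖(m i).J (ξ + (s : ℂ) • K ξ)
      - (((m i).A + (s : ℂ) • (m i).B) ((m i).J (R ξ)) - Complex.I • (m i).J (R ξ))‖) l (𝓝 0))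
    (g : C(circ, ℂ)) (ψ : E) :
    have := hS.isCayley.isStarNormal
    Tendsto (fun i => ‖((m i).res s).fc (fun x => g ⟨(u x)⁻¹, inv_u_mem_circ x⟩) ((m i).J ψ)
      - (m i).J (cfcHomSuperset (a := S) this hS.isCayley.spectrum_subset g ψ)‖) l (𝓝 0) := by
  intro hSn
  have hTid : cfcHomSuperset (a := S) hSn hS.isCayley.spectrum_subset (.restrict circ <| .id ℂ) = S :=
    cfcHomSuperset_id (a := S) hSn hS.isCayley.spectrum_subset
  set T := cfcHomSuperset (a := S) hSn hS.isCayley.spectrum_subset with hT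
  have hfcn : ∀ (i : I) (g : C(circ, ℂ)),
      ‖((m i).res s).fc (fun x => g ⟨(u x)⁻¹, inv_u_mem_circ x⟩)‖ ≤ ‖g‖ := fun i g =>
    SpectralRes.norm_fc_le _ _ (norm_nonneg _) fun x => g.norm_coe_le_norm _
  have hTn : ∀ g, ‖T g‖ ≤ ‖g‖ := fun g => NonUnitalStarAlgHom.norm_apply_le T g
  have hGu : ∀ (i : I) (x : (m i).X), ((m i).res s).fc (fun x => (u x)⁻¹)
      (((m i).A + (s : ℂ) • (m i).B) x - Complex.I • x) = x := fun i x => by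
    have h1 : ((m i).res s).fc (fun x => (u x)⁻¹) * ((m i).res s).fc u = 1 := by
      rw [← SpectralRes.fc_mul]
      simp [inv_mul_cancel₀ (u_ne_zero _), SpectralRes.fc_const]
    rw [SpectralRes.fc_u] at h1
    have := congrArg (fun T : (m i).X →L[ℂ] (m i).X => T x) h1
    simpa using this
  have hGu' : ∀ (i : I) (x : (m i).X), ((m i).res s).fc (fun x => star (u x)⁻¹)
      (((m i).A + (s : ℂ) • (m i).B) x + Complex.I • x) = x := fun i x => by
    have h1 : ((m i).res s).fc (fun x => star (u x)⁻¹) *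
        ((m i).res s).fc (fun x => u x + 2 * Complex.I) = 1 := by
      rw [← SpectralRes.fc_mul]
      have : ∀ x, star (u x)⁻¹ * (u x + 2 * Complex.I) = 1 := fun x => by
        have : u x + 2 * Complex.I = star (u x) := by simp [u]; ring
        rw [this, ← star_mul, mul_inv_cancel₀ (u_ne_zero x), star_one]
      rw [show (fun x => star (u x)⁻¹ * (u x + 2 * Complex.I)) = fun _ => 1 from funext this,
        SpectralRes.fc_const, one_smul]
    rw [SpectralRes.fc_add, SpectralRes.fc_u, SpectralRes.fc_const] at h1
    have := congrArg (fun T : (m i).X →L[ℂ] (m i).X => T x) h1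
    have e : ((m i).A + (s : ℂ) • (m i).B) x + Complex.I • x
        = ((m i).A + (s : ℂ) • (m i).B - Complex.I • 1 + (2 * Complex.I) • 1) x := by
      simp only [add_apply, sub_apply, smul_apply, one_apply_eq_self]
      module
    rw [e]
    exact this
  -- Stone–Weierstrass: constants, the coordinate and its conjugate generate. The vector varies
  -- because a product uses the claim for `g` at `T h ψ`.
  induction g using ContinuousMap.induction_on_of_compact generalizing ψ with
  | const c =>
    have h : T (.const circ c) = c • 1 := by
      have : (ContinuousMap.const circ c : C(circ, ℂ)) = algebraMap ℂ C(circ, ℂ) c := rfl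
      rw [this, AlgHomClass.commutes, Algebra.algebraMap_eq_smul_one]
    refine tendsto_const_nhds.congr fun i => ?_
    have h' : ((m i).res s).fc (fun x => (ContinuousMap.const circ c) ⟨(u x)⁻¹, inv_u_mem_circ x⟩)
        = c • 1 := SpectralRes.fc_const _ c
    rw [h, h', smul_apply, smul_apply, one_apply_eq_self, one_apply_eq_self, map_smul, sub_self,
      norm_zero]
  | id =>
    -- Here `S ψ = R ξ`, and by `hm` the model operator minus `i` sends `J (R ξ)` almost to `J ψ`;
    -- the model resolvent, a contraction, is then applied.
    obtain ⟨ξ, h1, h2⟩ := hS.exists_eq ψ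
    rw [hTid]
    refine squeeze_zero (fun i => norm_nonneg _) (fun i => ?_) (hm ξ)
    have e : (((m i).res s).fc fun x => (u x)⁻¹) ((m i).J ψ) - (m i).J (S ψ)
        = ((m i).res s).fc (fun x => (u x)⁻¹) ((m i).J (ξ + (s : ℂ) • K ξ)
      - (((m i).A + (s : ℂ) • (m i).B) ((m i).J (R ξ)) - Complex.I • (m i).J (R ξ))) := by
      rw [map_sub, hGu, ← h2, h1]
    refine (le_of_eq (congrArg _ e)).trans ?_
    refine (ContinuousLinearMap.le_of_opNorm_le _ (SpectralRes.norm_fc_le _ _ zero_le_one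
      fun x => ?_) _).trans (one_mul _).le
    rw [norm_inv]; exact inv_le_one_of_one_le₀ (one_le_norm_u x)
  | star_id =>
    obtain ⟨ξ, h1, h2⟩ := hS.exists_eq (ψ - (2 * Complex.I) • star S ψ)
    rw [map_star, hTid]
    refine squeeze_zero (fun i => norm_nonneg _) (fun i => ?_) (hm ξ)
    have h3 : star S ψ = R ξ := by rw [hS.isCayley.star_eq ψ, h1]
    have h4 : ψ = ξ + (s : ℂ) • K ξ + (2 * Complex.I) • R ξ := by
      rw [← h2, h3]; abel
    have e : (((m i).res s).fc fun x => star (u x)⁻¹) ((m i).J ψ) - (m i).J (star S ψ)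
        = ((m i).res s).fc (fun x => star (u x)⁻¹) ((m i).J (ξ + (s : ℂ) • K ξ)
      - (((m i).A + (s : ℂ) • (m i).B) ((m i).J (R ξ)) - Complex.I • (m i).J (R ξ))) := by
      have e1 : (m i).J (ξ + (s : ℂ) • K ξ)
          - (((m i).A + (s : ℂ) • (m i).B) ((m i).J (R ξ)) - Complex.I • (m i).J (R ξ))
          = (m i).J ψ
            - (((m i).A + (s : ℂ) • (m i).B) ((m i).J (R ξ)) + Complex.I • (m i).J (R ξ)) := by
        conv_rhs => rw [h4, map_add, map_smul]
        module
      rw [e1, map_sub, hGu', h3]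
    refine (le_of_eq (congrArg _ e)).trans ?_
    refine (ContinuousLinearMap.le_of_opNorm_le _ (SpectralRes.norm_fc_le _ _ zero_le_one
      fun x => ?_) _).trans (one_mul _).le
    rw [norm_star, norm_inv]; exact inv_le_one_of_one_le₀ (one_le_norm_u x)
  | add g h hg hh =>
    refine squeeze_zero (fun i => norm_nonneg _) (fun i => ?_)
      (by simpa using (hg ψ).add (hh ψ))
    refine le_trans (le_of_eq (congrArg _ ?_)) (norm_add_le _ _)
    have := SpectralRes.fc_add ((m i).res s) (fun x => g ⟨(u x)⁻¹, inv_u_mem_circ x⟩)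
      (fun x => h ⟨(u x)⁻¹, inv_u_mem_circ x⟩)
    simp only [ContinuousMap.add_apply, map_add, add_apply, this]
    abel
  | mul g h hg hh =>
    refine squeeze_zero (fun i => norm_nonneg _) (fun i => ?_)
      (by simpa using ((hh ψ).const_mul ‖g‖).add (hg (T h ψ)))
    have := SpectralRes.fc_mul ((m i).res s) (fun x => g ⟨(u x)⁻¹, inv_u_mem_circ x⟩)
      (fun x => h ⟨(u x)⁻¹, inv_u_mem_circ x⟩)
    have e : ((m i).res s).fc (fun x => (g * h) ⟨(u x)⁻¹, inv_u_mem_circ x⟩) ((m i).J ψ)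
        - (m i).J (T (g * h) ψ)
        = ((m i).res s).fc (fun x => g ⟨(u x)⁻¹, inv_u_mem_circ x⟩)
          (((m i).res s).fc (fun x => h ⟨(u x)⁻¹, inv_u_mem_circ x⟩) ((m i).J ψ)
            - (m i).J (T h ψ))
          + (((m i).res s).fc (fun x => g ⟨(u x)⁻¹, inv_u_mem_circ x⟩) ((m i).J (T h ψ))
            - (m i).J (T g (T h ψ))) := by
      simp only [ContinuousMap.mul_apply, map_mul, mul_apply_eq_comp, this, map_sub]
      abel
    rw [e]
    refine (norm_add_le _ _).trans (add_le_add ?_ le_rfl)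
    exact ContinuousLinearMap.le_of_opNorm_le _ (hfcn i g) _
  | frequently f hf =>
    rw [Metric.tendsto_nhds]
    intro ε hε
    have hη : 0 < ε / (4 * (‖ψ‖ + 1)) := by positivity
    obtain ⟨g, hg, hgf⟩ := (hf.and_eventually (Metric.ball_mem_nhds f hη)).exists
    have hgf' : ‖g - f‖ < ε / (4 * (‖ψ‖ + 1)) := by rwa [← dist_eq_norm]
    have hsm : ‖g - f‖ * ‖ψ‖ ≤ ε / 4 := by
      have h1 : ‖g - f‖ * ‖ψ‖ ≤ ε / (4 * (‖ψ‖ + 1)) * ‖ψ‖ :=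
        mul_le_mul_of_nonneg_right hgf'.le (norm_nonneg _)
      refine h1.trans ?_
      rw [div_mul_eq_mul_div, div_le_div_iff₀ (by positivity) (by norm_num)]
      nlinarith [norm_nonneg ψ]
    filter_upwards [(Metric.tendsto_nhds.1 (hg ψ)) (ε / 4) (by positivity)] with i hi
    rw [dist_zero_right, norm_norm] at hi ⊢
    have e : ((m i).res s).fc (fun x => f ⟨(u x)⁻¹, inv_u_mem_circ x⟩) ((m i).J ψ)
        - (m i).J (T f ψ)
        = (((m i).res s).fc (fun x => g ⟨(u x)⁻¹, inv_u_mem_circ x⟩) ((m i).J ψ)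
            - (m i).J (T g ψ))
          - ((((m i).res s).fc (fun x => (g - f) ⟨(u x)⁻¹, inv_u_mem_circ x⟩) ((m i).J ψ))
            - (m i).J (T (g - f) ψ)) := by
      have := SpectralRes.fc_sub ((m i).res s) (fun x => g ⟨(u x)⁻¹, inv_u_mem_circ x⟩)
        (fun x => f ⟨(u x)⁻¹, inv_u_mem_circ x⟩)
      simp only [ContinuousMap.sub_apply, map_sub, sub_apply, this]
      abel
    rw [e]
    have b1 : ‖((m i).res s).fc (fun x => (g - f) ⟨(u x)⁻¹, inv_u_mem_circ x⟩) ((m i).J ψ)‖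
        ≤ ‖g - f‖ * ‖ψ‖ := (ContinuousLinearMap.le_of_opNorm_le _ (hfcn i (g - f)) _).trans
      (mul_le_mul_of_nonneg_left ((m i).norm_J_le ψ) (norm_nonneg _))
    have b2 : ‖(m i).J (T (g - f) ψ)‖ ≤ ‖g - f‖ * ‖ψ‖ := ((m i).norm_J_le _).trans
      (ContinuousLinearMap.le_of_opNorm_le _ (hTn (g - f)) ψ)
    calc _ ≤ _ := norm_sub_le _ _
      _ ≤ _ := add_le_add le_rfl (norm_sub_le _ _)
      _ < ε := by linarith

lemma tendsto_fc (hS : IsPerturbed R K s S)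
    (hm : ∀ ξ, Tendsto (fun i => ‖(m i).J (ξ + (s : ℂ) • K ξ)
      - (((m i).A + (s : ℂ) • (m i).B) ((m i).J (R ξ)) - Complex.I • (m i).J (R ξ))‖) l (𝓝 0))
    {f : ℝ → ℂ} (hf : IsC₀ f) (ψ : E) :
    Tendsto (fun i => ‖((m i).res s).fc f ((m i).J ψ) - (m i).J (fcalc S f ψ)‖) l (𝓝 0) := by
  have := tendsto_fc_circ hS hm ⟨_, (continuousOn_lift hf).domRestrict⟩ ψ
  have hSn := hS.isCayley.isStarNormal
  convert this using 5 with i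
  · congr 1
    ext x
    exact (lift_inv_u f x).symm
  · rw [fcalc, cfc_apply (lift f) S hSn (hS.isCayley.continuousOn_lift hf)]
    rfl

/-- The compression of an operator on the model to the original space. -/
def FinModel.compress (m : FinModel E) (T : m.X →L[ℂ] m.X) : E →L[ℂ] E :=
  have : CompleteSpace m.X := FiniteDimensional.complete ℂ _
  (ContinuousLinearMap.adjoint m.J).comp (T.comp m.J)

lemma FinModel.inner_compress (m : FinModel E) (T : m.X →L[ℂ] m.X) (ψ φ : E) :
    Inner.inner ℂ (m.compress T ψ) φ = Inner.inner ℂ (T (m.J ψ)) (m.J φ) := by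
  have : CompleteSpace m.X := FiniteDimensional.complete ℂ _
  rw [← ContinuousLinearMap.adjoint_inner_left]
  rfl

lemma FinModel.norm_compress_le (m : FinModel E) (T : m.X →L[ℂ] m.X) :
    ‖m.compress T‖ ≤ ‖T‖ := by
  have : CompleteSpace m.X := FiniteDimensional.complete ℂ _
  have h1 : ‖m.J‖ ≤ 1 := ContinuousLinearMap.opNorm_le_bound _ zero_le_one fun ψ => by
    simpa using m.norm_J_le ψ
  calc ‖m.compress T‖ ≤ ‖ContinuousLinearMap.adjoint m.J‖ * ‖T.comp m.J‖ :=
        ContinuousLinearMap.opNorm_comp_le _ _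
    _ ≤ 1 * (‖T‖ * 1) := by
        refine mul_le_mul ?_ ((ContinuousLinearMap.opNorm_comp_le _ _).trans
          (mul_le_mul_of_nonneg_left h1 (norm_nonneg _))) (norm_nonneg _) zero_le_one
        rw [LinearIsometryEquiv.norm_map]
        exact h1
    _ = ‖T‖ := by ring

/-- There are families of models converging to the given operators. -/
lemma exists_tendsto_finModel (hR : IsCayley R) (hd : DenseRange R)
    (hRK : ∀ x y, inner ℂ (K x) (R y) = inner ℂ (R x) (K y)) :
    ∃ (m : ℕ × Finset E → FinModel E) (δ : ℕ × Finset E → ℝ), (∀ i, 0 < δ i) ∧ (∀ i, δ i ≤ 1) ∧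
      Tendsto δ atTop (𝓝 0) ∧
      (∀ i x, ‖(m i).B x‖ ≤ ‖K‖ * (1 + δ i) * ‖(m i).A x - Complex.I • x‖) ∧
      (∀ (s : ℝ) (ξ : E), Tendsto (fun i => ‖(m i).J (ξ + (s : ℂ) • K ξ)
        - (((m i).A + (s : ℂ) • (m i).B) ((m i).J (R ξ)) - Complex.I • (m i).J (R ξ))‖)
        atTop (𝓝 0)) ∧
      ∀ η φ : E, Tendsto (fun i => Inner.inner ℂ ((m i).J η) ((m i).J φ)) atTop
        (𝓝 (Inner.inner ℂ η φ)) := by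
  classical
  -- Along this directed set `δ → 0`, and every vector eventually lies in the finite set.
  let δ : ℕ × Finset E → ℝ := fun i => 1 / ((i.1 : ℝ) + 1)
  have hδ : ∀ i, 0 < δ i := fun i => by positivity
  have hδ1 : ∀ i, δ i ≤ 1 := fun i => by
    refine (div_le_one (by positivity)).2 ?_
    linarith [(Nat.cast_nonneg i.1 : (0 : ℝ) ≤ i.1)]
  have hδt : Tendsto δ atTop (𝓝 0) := by
    refine (tendsto_one_div_add_atTop_nhds_zero_nat (𝕜 := ℝ)).comp ?_
    rw [← prod_atTop_atTop_eq]
    exact tendsto_fst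
  have hmem : ∀ ξ : E, ∀ᶠ i : ℕ × Finset E in atTop, ξ ∈ i.2 := fun ξ => by
    filter_upwards [eventually_ge_atTop ((0, {ξ}) : ℕ × Finset E)] with i hi
    exact hi.2 (Finset.mem_singleton_self ξ)
  choose m hm using fun i : ℕ × Finset E => exists_finModel hR hd hRK (hδ i) i.2
  have hm' : ∀ (s : ℝ) (ξ : E), Tendsto (fun i => ‖(m i).J (ξ + (s : ℂ) • K ξ)
      - (((m i).A + (s : ℂ) • (m i).B) ((m i).J (R ξ)) - Complex.I • (m i).J (R ξ))‖)
      atTop (𝓝 0) := fun s ξ => by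
    have h0 : Tendsto (fun i => δ i * ‖R ξ‖ + |s| * (‖K‖ * δ i)) atTop (𝓝 0) := by
      simpa using (hδt.mul_const ‖R ξ‖).add ((hδt.const_mul ‖K‖).const_mul |s|)
    refine squeeze_zero' (Eventually.of_forall fun i => norm_nonneg _) ?_ h0
    filter_upwards [hmem ξ] with i hi
    have e : (m i).J (ξ + (s : ℂ) • K ξ)
        - (((m i).A + (s : ℂ) • (m i).B) ((m i).J (R ξ)) - Complex.I • (m i).J (R ξ))
        = -((m i).A ((m i).J (R ξ)) - Complex.I • (m i).J (R ξ) - (m i).J ξ)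
          - (s : ℂ) • ((m i).B ((m i).J (R ξ)) - (m i).J (K ξ)) := by
      rw [map_add, map_smul, add_apply, smul_apply]
      module
    rw [e]
    refine (norm_sub_le _ _).trans (add_le_add ?_ ?_)
    · rw [norm_neg]
      exact (hm i).norm_A_sub_le ξ hi
    · rw [norm_smul, Complex.norm_real, Real.norm_eq_abs]
      exact mul_le_mul_of_nonneg_left ((hm i).norm_B_sub_le ξ hi) (abs_nonneg s)
  have hJ : ∀ η φ : E, Tendsto (fun i => Inner.inner ℂ ((m i).J η) ((m i).J φ)) atTop
      (𝓝 (Inner.inner ℂ η φ)) := fun η φ => by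
    rw [tendsto_iff_norm_sub_tendsto_zero, Metric.tendsto_nhds]
    intro ε hε
    obtain ⟨ξ, hξ⟩ := hd.exists_dist_lt φ (show 0 < ε / (4 * (‖η‖ + 1)) by positivity)
    rw [dist_eq_norm] at hξ
    have hsm : ‖η‖ * ‖φ - R ξ‖ ≤ ε / 4 := by
      refine (mul_le_mul_of_nonneg_left hξ.le (norm_nonneg _)).trans ?_
      rw [mul_div_assoc', div_le_div_iff₀ (by positivity) (by norm_num)]
      nlinarith [norm_nonneg η]
    have h1 : Tendsto (fun i => ‖η‖ * δ i) atTop (𝓝 0) := by simpa using hδt.const_mul ‖η‖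
    filter_upwards [hmem ξ, (Metric.tendsto_nhds.1 h1) (ε / 4) (by positivity)] with i hi hi'
    rw [dist_zero_right, Real.norm_of_nonneg (by have := hδ i; positivity)] at hi'
    rw [dist_zero_right, norm_norm]
    have e : Inner.inner ℂ ((m i).J η) ((m i).J φ) - Inner.inner ℂ η φ
        = (Inner.inner ℂ ((m i).J η) ((m i).J (R ξ)) - Inner.inner ℂ η (R ξ))
          + (Inner.inner ℂ ((m i).J η) ((m i).J (φ - R ξ)) - Inner.inner ℂ η (φ - R ξ)) := by
      rw [map_sub, inner_sub_right, inner_sub_right]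
      ring
    have b1 : ‖Inner.inner ℂ ((m i).J η) ((m i).J (φ - R ξ))‖ ≤ ‖η‖ * ‖φ - R ξ‖ :=
      (norm_inner_le_norm _ _).trans (mul_le_mul ((m i).norm_J_le _) ((m i).norm_J_le _)
        (norm_nonneg _) (norm_nonneg _))
    have b2 : ‖Inner.inner ℂ η (φ - R ξ)‖ ≤ ‖η‖ * ‖φ - R ξ‖ := norm_inner_le_norm _ _
    rw [e]
    calc _ ≤ _ := norm_add_le _ _
      _ ≤ _ := add_le_add ((hm i).norm_inner_sub_le ξ hi η) (norm_sub_le _ _)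
      _ < ε := by linarith
  exact ⟨m, δ, hδ, hδ1, hδt, fun i => (hm i).norm_B_le, hm', hJ⟩

/-- The Taylor expansion of `s ↦ f(H + sV)` with a bound of the remainder, in terms of the
resolvents of the operators `H + sV` at `i`. -/
lemma exists_taylor (hR : IsCayley R) (hd : DenseRange R)
    (hRK : ∀ x y, inner ℂ (K x) (R y) = inner ℂ (R x) (K y)) {f : ℝ → ℂ} (hf : ContDiff ℝ ∞ f)
    (hf0 : IsC₀ f) (μ : ℕ → ComplexMeasure ℝ) (hμ : ∀ n, IsFourierOf (weightedDeriv f n) (μ n))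
    {b : ℕ → ℝ} (hb : ∀ p, (μ p).variation.real Set.univ / p.factorial ≤ b p) :
    ∃ a : ℕ → E →L[ℂ] E, (∀ n, ‖a n‖ ≤ ‖K‖ ^ n * beta b n 0) ∧
      ∀ s S, IsPerturbed R K s S → ∀ n,
        ‖fcalc S f - ∑ k ∈ Finset.range n, (s : ℂ) ^ k • a k‖
          ≤ |s| ^ n * (‖K‖ ^ n * beta b n 0) := by
  classical
  have hb0 : ∀ p, 0 ≤ b p := fun p => le_trans (by positivity) (hb p)
  obtain ⟨m, δ, hδ, hδ1, hδt, hB, hm', hJ⟩ := exists_tendsto_finModel hR hd hRK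
  have hcomp : ∀ i, CompleteSpace (m i).X := fun i => FiniteDimensional.complete ℂ _
  have hr0 : ∀ i, 0 ≤ ‖K‖ * (1 + δ i) := fun i => by have := hδ i; positivity
  choose a ha1 ha2 using fun i => exists_taylor_finiteDimensional hf μ hμ hb
    (spectralRes (m i).A (m i).symm_A) (hr0 i) (hB i)
  have hrt : ∀ n, Tendsto (fun i => (‖K‖ * (1 + δ i)) ^ n * beta b n 0) atTop
      (𝓝 (‖K‖ ^ n * beta b n 0)) := fun n => by
    have := ((hδt.const_add 1).const_mul ‖K‖).pow n |>.mul_const (beta b n 0)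
    simpa using this
  -- One ultrafilter gives limits of all coefficients at once, chosen before `s` and `S`, so they
  -- serve every `s`.
  let 𝒰 : Ultrafilter (ℕ × Finset E) := Ultrafilter.of atTop
  have h𝒰 : (𝒰 : Filter (ℕ × Finset E)) ≤ atTop := Ultrafilter.of_le _
  have hL : ∀ n, ∃ L : E →L[ℂ] E, ∀ ψ φ, Tendsto (fun i => Inner.inner ℂ ((m i).compress (a i n) ψ) φ) 𝒰
      (𝓝 (Inner.inner ℂ (L ψ) φ)) := fun n =>
    exists_weak_limit 𝒰 (M := (‖K‖ * 2) ^ n * beta b n 0) _ fun i => by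
      refine ((m i).norm_compress_le _).trans ((ha1 i n).trans ?_)
      have := hδ1 i
      refine mul_le_mul_of_nonneg_right (pow_le_pow_left₀ (hr0 i) ?_ n) (beta_nonneg hb0 _ _)
      exact mul_le_mul_of_nonneg_left (by linarith) (norm_nonneg _)
  choose L hL using hL
  refine ⟨L, fun n => norm_le_of_weak_limit (hL n) (fun i => ((m i).norm_compress_le _).trans (ha1 i n))
    ((hrt n).mono_left h𝒰), fun s S hS n => ?_⟩
  refine norm_le_of_weak_limit (l := (𝒰 : Filter (ℕ × Finset E)))
    (T := fun i => (m i).compress (((m i).res s).fc f - ∑ k ∈ Finset.range n, (s : ℂ) ^ k • a i k))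
    (fun ψ φ => ?_) (fun i => ((m i).norm_compress_le _).trans (ha2 i s ((m i).res s) n))
    (((hrt n).const_mul (|s| ^ n)).mono_left h𝒰)
  have h1 : Tendsto (fun i => Inner.inner ℂ (((m i).res s).fc f ((m i).J ψ)) ((m i).J φ)) 𝒰
      (𝓝 (Inner.inner ℂ (fcalc S f ψ) φ)) := by
    have h2 : Tendsto (fun i => Inner.inner ℂ (((m i).res s).fc f ((m i).J ψ)
        - (m i).J (fcalc S f ψ)) ((m i).J φ)) atTop (𝓝 0) := by
      refine squeeze_zero_norm (fun i => ?_)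
        (by simpa using (tendsto_fc hS (hm' s) hf0 ψ).mul_const ‖φ‖)
      exact (norm_inner_le_norm _ _).trans
        (mul_le_mul_of_nonneg_left ((m i).norm_J_le _) (norm_nonneg _))
    have h3 := h2.add (hJ (fcalc S f ψ) φ)
    rw [zero_add] at h3
    refine (h3.mono_left h𝒰).congr fun i => ?_
    rw [inner_sub_left, sub_add_cancel]
  have h2 : Tendsto (fun i => ∑ k ∈ Finset.range n,
      starRingEnd ℂ ((s : ℂ) ^ k) * Inner.inner ℂ ((m i).compress (a i k) ψ) φ) 𝒰
      (𝓝 (∑ k ∈ Finset.range n, starRingEnd ℂ ((s : ℂ) ^ k) * Inner.inner ℂ (L k ψ) φ)) :=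
    tendsto_finsetSum _ fun k _ => (hL k ψ φ).const_mul _
  have h3 := h1.sub h2
  have e : ∀ (i : ℕ × Finset E), Inner.inner ℂ ((m i).compress (((m i).res s).fc f
      - ∑ k ∈ Finset.range n, (s : ℂ) ^ k • a i k) ψ) φ
      = Inner.inner ℂ (((m i).res s).fc f ((m i).J ψ)) ((m i).J φ) - ∑ k ∈ Finset.range n,
      starRingEnd ℂ ((s : ℂ) ^ k) * Inner.inner ℂ ((m i).compress (a i k) ψ) φ := fun i => by
    simp only [FinModel.inner_compress, sub_apply, sum_apply, smul_apply, inner_sub_left, sum_inner,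
      inner_smul_left]
  simp only [e]
  convert h3 using 2
  simp only [sub_apply, sum_apply, smul_apply, inner_sub_left, sum_inner, inner_smul_left]

end Models

end RelTaylor
end

noncomputable section

namespace RelTaylor

/-! ### The converse of Taylor's theorem -/

section ConverseTaylor

variable {Y : Type*} [NormedAddCommGroup Y] [NormedSpace ℝ Y]

/-- The coefficients of a polynomial are bounded by its values at `0, …, n - 1`. -/
lemma exists_coeff_bound (n : ℕ) : ∃ C : ℝ, ∀ (e : ℕ → Y) (ε : ℝ),
    (∀ i < n, ‖∑ j ∈ Finset.range n, (i : ℝ) ^ j • e j‖ ≤ ε) → ∀ k < n, ‖e k‖ ≤ C * ε := by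
  let W : Matrix (Fin n) (Fin n) ℝ := Matrix.vandermonde fun i => ((i : ℕ) : ℝ)
  have hW : IsUnit W.det := by
    rw [isUnit_iff_ne_zero, Matrix.det_vandermonde_ne_zero_iff]
    exact fun i j h => Fin.ext (Nat.cast_injective h)
  refine ⟨∑ k, ∑ i, |W⁻¹ k i|, fun e ε h k hk => ?_⟩
  have hε : 0 ≤ ε := (norm_nonneg _).trans (h k hk)
  have h1 : e k = ∑ i, W⁻¹ ⟨k, hk⟩ i • ∑ j ∈ Finset.range n, ((i : ℕ) : ℝ) ^ j • e j := by
    simp only [Finset.smul_sum, smul_smul, Finset.sum_range]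
    rw [Finset.sum_comm]
    simp only [← Finset.sum_smul]
    have h2 : ∀ j : Fin n, ∑ i : Fin n, W⁻¹ ⟨k, hk⟩ i * ((i : ℕ) : ℝ) ^ (j : ℕ)
        = (1 : Matrix (Fin n) (Fin n) ℝ) ⟨k, hk⟩ j := fun j => by
      rw [← Matrix.nonsing_inv_mul W hW, Matrix.mul_apply]
      rfl
    simp only [h2, Matrix.one_apply]
    simp
  rw [h1]
  calc _ ≤ ∑ i, ‖W⁻¹ ⟨k, hk⟩ i • ∑ j ∈ Finset.range n, ((i : ℕ) : ℝ) ^ j • e j‖ := norm_sum_le _ _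
    _ ≤ ∑ i, |W⁻¹ ⟨k, hk⟩ i| * ε := Finset.sum_le_sum fun i _ => by
        rw [norm_smul, Real.norm_eq_abs]
        exact mul_le_mul_of_nonneg_left (h i i.2) (abs_nonneg _)
    _ ≤ _ := by
        rw [← Finset.sum_mul]
        refine mul_le_mul_of_nonneg_right ?_ hε
        exact Finset.single_le_sum (f := fun k => ∑ i, |W⁻¹ k i|)
          (fun k _ => Finset.sum_nonneg fun i _ => abs_nonneg _) (Finset.mem_univ (⟨k, hk⟩ : Fin n))

variable {F : ℝ → Y} {r : ℝ} {a : ℕ → ℝ → Y} {M : ℕ → ℝ}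

/-- Expanding `F (t + (i + 1) x)` around `t` and around `t + x` gives two polynomials in `i` that
agree up to `O(|x|ⁿ)` at `i = 0, …, n - 1`. Comparing coefficients gives `a k (t + x) = ∑ j, (j
choose k) x^(j-k) a j t + O(|x|^(n-k))`; the choice `n = k + 2` leaves a quadratic error. -/
lemma hasDerivAt_of_taylor (h : ∀ t s : ℝ, |t| < r → |t + s| < r → ∀ n,
    ‖F (t + s) - ∑ k ∈ Finset.range n, s ^ k • a k t‖ ≤ M n * |s| ^ n)
    (k : ℕ) {t : ℝ} (ht : |t| < r) : HasDerivAt (a k) (((k : ℝ) + 1) • a (k + 1) t) t := by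
  set n := k + 2 with hn
  obtain ⟨C, hC⟩ := exists_coeff_bound (Y := Y) n
  have hM : 0 ≤ |M n| := abs_nonneg _
  set D : ℝ := C * (2 * |M n| * (n : ℝ) ^ n) with hD
  have hbinom : ∀ (i : ℝ), ∀ j < n, (i + 1) ^ j
      = ∑ p ∈ Finset.range n, (j.choose p : ℝ) * i ^ p := fun i j hj => by
    rw [add_pow]
    simp only [one_pow, mul_one]
    rw [← Finset.sum_subset (Finset.range_subset_range.2 (Nat.succ_le_of_lt hj))
      fun p _ hp => by
        rw [Nat.choose_eq_zero_of_lt (by simpa using hp), Nat.cast_zero, zero_mul]]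
    exact Finset.sum_congr rfl fun p _ => mul_comm _ _
  -- The condition on `x` keeps all points `t + c x`, `0 ≤ c ≤ n`, in the interval.
  have key : ∀ x : ℝ, n * |x| < r - |t| →
      ‖a k (t + x) - a k t - x • (((k : ℝ) + 1) • a (k + 1) t)‖ ≤ D * x ^ 2 := by
    intro x hx
    rcases eq_or_ne x 0 with rfl | hx0
    · simp
    have hn1 : (1 : ℝ) ≤ n := by rw [hn]; push_cast; linarith [(Nat.cast_nonneg k : (0:ℝ) ≤ k)]
    have hin : ∀ c : ℝ, 0 ≤ c → c ≤ n → |t + c * x| < r := fun c hc hcn => by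
      refine (abs_add_le _ _).trans_lt ?_
      rw [abs_mul, abs_of_nonneg hc]
      have := mul_le_mul_of_nonneg_right hcn (abs_nonneg x)
      linarith
    have h1 := hC (fun p => x ^ p • a p (t + x)
        - ∑ j ∈ Finset.range n, ((j.choose p : ℝ) * x ^ j) • a j t)
      (2 * |M n| * (n : ℝ) ^ n * |x| ^ n) (fun i hi => ?_) k (by omega)
    · have h2 : ∑ j ∈ Finset.range n, ((j.choose k : ℝ) * x ^ j) • a j t
          = x ^ k • (a k t + x • (((k : ℝ) + 1) • a (k + 1) t)) := by
        rw [hn, Finset.sum_range_succ, Finset.sum_range_succ, Finset.sum_eq_zero, zero_add,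
          Nat.choose_self, Nat.choose_succ_self_right, smul_add, smul_smul, smul_smul]
        · push_cast
          rw [one_mul]
          congr 2
          ring
        · intro j hj
          rw [Nat.choose_eq_zero_of_lt (Finset.mem_range.1 hj)]
          simp
      rw [h2, ← smul_sub, norm_smul, norm_pow, Real.norm_eq_abs, ← sub_sub] at h1
      have h3 : (0 : ℝ) < |x| ^ k := by positivity
      refine le_of_mul_le_mul_left (h1.trans (le_of_eq ?_)) h3
      rw [hD, ← sq_abs x, hn, pow_add]
      ring
    · have e : ∑ p ∈ Finset.range n, (i : ℝ) ^ p • (x ^ p • a p (t + x)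
          - ∑ j ∈ Finset.range n, ((j.choose p : ℝ) * x ^ j) • a j t)
          = (F (t + ((i : ℝ) + 1) * x) - ∑ j ∈ Finset.range n, (((i : ℝ) + 1) * x) ^ j • a j t)
          - (F (t + x + i * x) - ∑ p ∈ Finset.range n, ((i : ℝ) * x) ^ p • a p (t + x)) := by
        have e1 : ∑ j ∈ Finset.range n, (((i : ℝ) + 1) * x) ^ j • a j t
            = ∑ p ∈ Finset.range n, (i : ℝ) ^ p • ∑ j ∈ Finset.range n,
              ((j.choose p : ℝ) * x ^ j) • a j t := by
          simp only [Finset.smul_sum]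
          rw [Finset.sum_comm]
          refine Finset.sum_congr rfl fun j hj => ?_
          rw [mul_pow, hbinom i j (Finset.mem_range.1 hj), Finset.sum_mul, Finset.sum_smul]
          refine Finset.sum_congr rfl fun p _ => ?_
          rw [smul_smul]
          congr 1
          ring
        rw [e1, show t + x + i * x = t + ((i : ℝ) + 1) * x by ring]
        simp only [smul_sub, Finset.sum_sub_distrib, smul_smul, mul_pow]
        abel
      rw [e]
      have hi' : (i : ℝ) + 1 ≤ n := by exact_mod_cast hi
      have hi0 : (0 : ℝ) ≤ i := Nat.cast_nonneg i
      have hb : ∀ c : ℝ, 0 ≤ c → c ≤ n → M n * |c * x| ^ n ≤ |M n| * (n : ℝ) ^ n * |x| ^ n :=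
        fun c hc hcn => by
          rw [abs_mul, mul_pow, abs_of_nonneg hc, ← mul_assoc]
          refine mul_le_mul_of_nonneg_right (mul_le_mul (le_abs_self _)
            (pow_le_pow_left₀ hc hcn n) (by positivity) hM) (by positivity)
      refine (norm_sub_le _ _).trans ((add_le_add
        ((h t _ ht (hin _ (by linarith) hi') n).trans (hb _ (by linarith) hi'))
        ((h (t + x) (i * x) (by simpa using hin 1 zero_le_one hn1) ?_ n).trans
          (hb _ hi0 (by linarith)))).trans (le_of_eq (by ring)))
      have := hin ((i : ℝ) + 1) (by linarith) hi'
      rwa [show t + x + i * x = t + ((i : ℝ) + 1) * x by ring]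
  rw [hasDerivAt_iff_isLittleO_nhds_zero]
  have hbig : (fun x => a k (t + x) - a k t - x • (((k : ℝ) + 1) • a (k + 1) t))
      =O[𝓝 0] fun x : ℝ => x ^ 2 := by
    refine Asymptotics.IsBigO.of_bound D ?_
    have h1 : Tendsto (fun x : ℝ => n * |x|) (𝓝 0) (𝓝 0) := by
      have : Continuous fun x : ℝ => n * |x| := by fun_prop
      simpa using this.tendsto 0
    filter_upwards [h1.eventually_lt_const (show 0 < r - |t| by linarith)] with x hx
    refine (key x hx).trans (le_of_eq ?_)
    rw [Real.norm_of_nonneg (sq_nonneg x)]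
  exact hbig.trans_isLittleO (Asymptotics.isLittleO_pow_id one_lt_two)

/-- A function with uniform Taylor expansions of all orders around all points is smooth. -/
theorem contDiffAt_of_taylor (hr : 0 < r) (h : ∀ t s : ℝ, |t| < r → |t + s| < r → ∀ n,
    ‖F (t + s) - ∑ k ∈ Finset.range n, s ^ k • a k t‖ ≤ M n * |s| ^ n) :
    ContDiffAt ℝ ∞ F 0 ∧ ∀ k, iteratedDeriv k F 0 = (k.factorial : ℝ) • a k 0 := by
  have hd := fun k (t : ℝ) (ht : |t| < r) => hasDerivAt_of_taylor h k ht
  have hopen : IsOpen {t : ℝ | |t| < r} := isOpen_lt continuous_abs continuous_const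
  have hmem : {t : ℝ | |t| < r} ∈ 𝓝 (0 : ℝ) := hopen.mem_nhds (by simpa using hr)
  have hF : ∀ t, |t| < r → F t = a 0 t := fun t ht => by
    have := h t 0 ht (by simpa using ht) 1
    simp only [add_zero, Finset.range_one, Finset.sum_singleton, pow_zero, one_smul, abs_zero,
      pow_one, mul_zero] at this
    exact sub_eq_zero.1 (norm_le_zero_iff.1 this)
  have hcd : ∀ n k : ℕ, ContDiffOn ℝ n (a k) {t : ℝ | |t| < r} := by
    intro n
    induction n with
    | zero =>
      intro k
      rw [Nat.cast_zero, contDiffOn_zero]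
      exact fun t ht => (hd k t ht).continuousAt.continuousWithinAt
    | succ n ih =>
      intro k
      rw [Nat.cast_succ, contDiffOn_succ_iff_deriv_of_isOpen hopen]
      refine ⟨fun t ht => (hd k t ht).differentiableAt.differentiableWithinAt,
        fun h => absurd h (by simp), ?_⟩
      exact ((ih (k + 1)).const_smul ((k : ℝ) + 1)).congr fun t ht => (hd k t ht).deriv
  have hit : ∀ k : ℕ, ∀ t, |t| < r → iteratedDeriv k F t = (k.factorial : ℝ) • a k t := by
    intro k
    induction k with
    | zero => intro t ht; simpa using hF t ht
    | succ k ih =>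
      intro t ht
      have : iteratedDeriv k F =ᶠ[𝓝 t] (k.factorial : ℝ) • a k := by
        filter_upwards [hopen.mem_nhds ht] with t ht using ih t ht
      rw [iteratedDeriv_succ, this.deriv_eq, ((hd k t ht).const_smul _).deriv, smul_smul,
        Nat.factorial_succ]
      push_cast
      rw [mul_comm]
  refine ⟨contDiffAt_infty.2 fun n => ?_, fun k => hit k 0 (by simpa using hr)⟩
  refine ((hcd n 0).contDiffAt hmem).congr_of_eventuallyEq ?_
  filter_upwards [hmem] with t ht using hF t ht

end ConverseTaylor

end RelTaylor
end

noncomputable section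

namespace RelTaylor

/-! ### Resolvents of self-adjoint operators -/

section Unbounded

variable {E : Type*} [NormedAddCommGroup E] [InnerProductSpace ℂ E]
  {A H V : E →ₗ.[ℂ] E}

lemma norm_sq_sub_smul (hA : A.IsFormalAdjoint A) (lam : ℝ) (ψ : A.domain) :
    ‖A ψ - ((lam : ℂ) * Complex.I) • (ψ : E)‖ ^ 2 = ‖A ψ‖ ^ 2 + lam ^ 2 * ‖(ψ : E)‖ ^ 2 := by
  have h1 : (inner ℂ (A ψ) (ψ : E)).im = 0 := by
    have h2 : starRingEnd ℂ (inner ℂ (A ψ) (ψ : E)) = inner ℂ (A ψ) (ψ : E) := by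
      rw [inner_conj_symm]
      exact (hA ψ ψ).symm
    exact Complex.conj_eq_iff_im.1 h2
  rw [@norm_sub_sq ℂ, inner_smul_right, norm_smul, mul_pow]
  simp [h1]

lemma norm_le_norm_sub_smul (hA : A.IsFormalAdjoint A) (lam : ℝ) (ψ : A.domain) :
    ‖A ψ‖ ≤ ‖A ψ - ((lam : ℂ) * Complex.I) • (ψ : E)‖ := by
  refine le_of_sq_le_sq ?_ (norm_nonneg _)
  rw [norm_sq_sub_smul hA]
  nlinarith [sq_nonneg (lam * ‖(ψ : E)‖)]

lemma abs_mul_norm_le_norm_sub_smul (hA : A.IsFormalAdjoint A) (lam : ℝ) (ψ : A.domain) :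
    |lam| * ‖(ψ : E)‖ ≤ ‖A ψ - ((lam : ℂ) * Complex.I) • (ψ : E)‖ := by
  refine le_of_sq_le_sq ?_ (norm_nonneg _)
  rw [norm_sq_sub_smul hA, mul_pow, sq_abs]
  nlinarith [sq_nonneg ‖A ψ‖]

lemma isFormalAdjoint_self [CompleteSpace E] (hA : IsSelfAdjoint A) : A.IsFormalAdjoint A := by
  have := LinearPMap.adjoint_isFormalAdjoint hA.dense_domain
  rwa [LinearPMap.isSelfAdjoint_def.1 hA] at this

/-- Nonzero imaginary numbers belong to the resolvent set of a self-adjoint operator. -/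
lemma exists_isResolvent [CompleteSpace E] (hA : IsSelfAdjoint A) {lam : ℝ} (hl : lam ≠ 0) :
    ∃ R, IsResolvent A ((lam : ℂ) * Complex.I) R := by
  have hs := isFormalAdjoint_self hA
  set z : ℂ := (lam : ℂ) * Complex.I with hz
  have hcl : IsClosed (A.graph : Set (E × E)) := hA.isClosed
  have hcs : CompleteSpace A.graph := hcl.completeSpace_coe
  -- `A - z` becomes a bounded operator on the graph, which is complete because `A` is closed.
  let T : A.graph →L[ℂ] E := (ContinuousLinearMap.snd ℂ E E - z • ContinuousLinearMap.fst ℂ E E).comp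
    A.graph.subtypeL
  have hT : ∀ p : A.graph, T p = (p : E × E).2 - z • (p : E × E).1 := fun p => rfl
  have hgr : ∀ p : A.graph, ∃ ψ : A.domain, (ψ : E) = (p : E × E).1 ∧ A ψ = (p : E × E).2 :=
    fun p => (LinearPMap.mem_graph_iff A).1 p.2
  have hanti : AntilipschitzWith (Real.toNNReal (1 + |lam|⁻¹)) T := by
    refine AddMonoidHomClass.antilipschitz_of_bound T fun p => ?_
    obtain ⟨ψ, h1, h2⟩ := hgr p
    rw [hT, ← h1, ← h2, Real.coe_toNNReal _ (by positivity)]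
    have b1 := norm_le_norm_sub_smul hs lam ψ
    have b2 := abs_mul_norm_le_norm_sub_smul hs lam ψ
    have h0 : 0 < |lam| := abs_pos.2 hl
    have b3 : ‖(ψ : E)‖ ≤ |lam|⁻¹ * ‖A ψ - z • (ψ : E)‖ := by
      rw [← div_eq_inv_mul, le_div_iff₀ h0, mul_comm]
      exact b2
    have b4 : ‖p‖ = max ‖(ψ : E)‖ ‖A ψ‖ := by rw [h1, h2]; rfl
    rw [b4, add_mul, one_mul]
    exact max_le (by linarith [norm_nonneg (A ψ - z • (ψ : E))])
      (b1.trans (le_add_of_nonneg_right (by positivity)))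
  have hrange : LinearMap.range (T : A.graph →ₗ[ℂ] E) = ⊤ := by
    have hclr : IsClosed (LinearMap.range (T : A.graph →ₗ[ℂ] E) : Set E) := by
      rw [LinearMap.coe_range]
      exact hanti.isClosed_range T.uniformContinuous
    have : (LinearMap.range (T : A.graph →ₗ[ℂ] E)).HasOrthogonalProjection := by
      have := hclr.completeSpace_coe
      infer_instance
    -- A vector orthogonal to the range satisfies `A y = z̄ y`, which forces `y = 0` as `z` is not
    -- real.
    rw [← Submodule.orthogonal_eq_bot_iff, Submodule.eq_bot_iff]
    intro y hy
    have h1 : ∀ ψ : A.domain, inner ℂ (starRingEnd ℂ z • y) (ψ : E) = inner ℂ y (A ψ) := by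
      intro ψ
      have := Submodule.inner_left_of_mem_orthogonal
        (LinearMap.mem_range_self (T : A.graph →ₗ[ℂ] E) ⟨_, A.mem_graph ψ⟩) hy
      rw [ContinuousLinearMap.coe_coe, hT, inner_sub_right, inner_smul_right, sub_eq_zero] at this
      rw [inner_smul_left, Complex.conj_conj, this]
    have hmem' := LinearPMap.mem_adjoint_domain_of_exists (T := A) y ⟨_, h1⟩
    have hval := LinearPMap.adjoint_apply_eq hA.dense_domain ⟨y, hmem'⟩ h1
    rw [LinearPMap.isSelfAdjoint_def] at hA
    have hmem : y ∈ A.domain := by rwa [hA] at hmem'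
    have hval' : A ⟨y, hmem⟩ = starRingEnd ℂ z • y := by
      rw [← hval]
      exact (le_of_eq hA.symm : A ≤ A.adjoint).2 rfl
    have h2 := norm_sq_sub_smul hs (-lam) ⟨y, hmem⟩
    have h3 : starRingEnd ℂ z = ((-lam : ℝ) : ℂ) * Complex.I := by rw [hz]; simp
    rw [hval', h3] at h2
    simp only [sub_self, norm_zero] at h2
    have h4 : lam ^ 2 * ‖y‖ ^ 2 ≤ 0 := by
      nlinarith [sq_nonneg ‖(((-lam : ℝ) : ℂ) * Complex.I) • y‖]
    have h5 : 0 < lam ^ 2 := by positivity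
    have h6 : ‖y‖ ^ 2 ≤ 0 := by
      by_contra h
      push Not at h
      nlinarith [mul_pos h5 h]
    exact norm_eq_zero.1 (pow_eq_zero_iff two_ne_zero |>.1 (le_antisymm h6 (sq_nonneg _)))
  let e := ContinuousLinearEquiv.ofBijective T (LinearMap.ker_eq_bot.2 hanti.injective) hrange
  have he : ∀ p, e p = T p := fun p => rfl
  refine ⟨(ContinuousLinearMap.fst ℂ E E).comp (A.graph.subtypeL.comp (e.symm : E →L[ℂ] A.graph)),
    fun x => ?_, fun x => ?_⟩
  · obtain ⟨ψ, h1, h2⟩ := hgr (e.symm x)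
    have h3 : T (e.symm x) = x := e.apply_symm_apply x
    rw [hT, ← h1, ← h2] at h3
    have h4 : ((ContinuousLinearMap.fst ℂ E E).comp
      (A.graph.subtypeL.comp (e.symm : E →L[ℂ] A.graph))) x = ψ := h1.symm
    refine ⟨h4 ▸ ψ.2, ?_⟩
    convert h3
  · have : e.symm (A x - z • (x : E)) = ⟨_, A.mem_graph x⟩ := by
      rw [ContinuousLinearEquiv.symm_apply_eq]
      rfl
    change ((e.symm (A x - z • (x : E)) : A.graph) : E × E).1 = x
    rw [this]

lemma isResolvent_resolventOp [CompleteSpace E] (hA : IsSelfAdjoint A) :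
    IsResolvent A Complex.I (resolventOp A Complex.I) := by
  have h : ∃ R, IsResolvent A Complex.I R := by
    simpa using exists_isResolvent hA (one_ne_zero (α := ℝ))
  rw [resolventOp, dif_pos h]
  exact h.choose_spec

/-- A symmetric operator `A` with `A ± iλ` surjective is self-adjoint. -/
lemma isSelfAdjoint_of_surjective [CompleteSpace E] (hs : A.IsFormalAdjoint A) (hd : Dense (A.domain : Set E))
    {z : ℂ} (h1 : ∀ y, ∃ ψ : A.domain, A ψ - z • (ψ : E) = y)
    (h2 : ∀ y, ∃ ψ : A.domain, A ψ - starRingEnd ℂ z • (ψ : E) = y) : IsSelfAdjoint A := by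
  have hle : A ≤ A.adjoint := LinearPMap.IsFormalAdjoint.le_adjoint hd hs
  rw [LinearPMap.isSelfAdjoint_def]
  refine (LinearPMap.eq_of_le_of_domain_eq hle (le_antisymm hle.1 fun y hy => ?_)).symm
  -- `(A - z) ψ = (A* - z) y` makes `y - ψ` orthogonal to the range of `A - z̄`; `φ` is chosen to
  -- test it against itself.
  obtain ⟨ψ, hψ⟩ := h1 (A.adjoint ⟨y, hy⟩ - z • y)
  obtain ⟨φ, hφ⟩ := h2 (y - ψ)
  have h3 := LinearPMap.adjoint_isFormalAdjoint hd ⟨y, hy⟩ φ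
  have h4 := hs ψ φ
  have h5 : inner ℂ (y - (ψ : E)) (y - (ψ : E)) = 0 := by
    have h7 : inner ℂ (y - (ψ : E)) (y - (ψ : E))
        = inner ℂ (y - (ψ : E)) (A φ - starRingEnd ℂ z • (φ : E)) := by rw [hφ]
    rw [h7, inner_sub_right, inner_sub_left, inner_sub_left, inner_smul_right, inner_smul_right]
    have h6 : A.adjoint ⟨y, hy⟩ = A ψ - z • (ψ : E) + z • y := by rw [hψ]; abel
    rw [h6, inner_add_left, inner_sub_left, inner_smul_left, inner_smul_left] at h3
    change _ = inner ℂ y (A φ) at h3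
    rw [← h3, ← h4]
    ring
  have h6 : y = ψ := sub_eq_zero.1 (inner_self_eq_zero.1 h5)
  rw [h6]
  exact ψ.2

/-- `U` sends `(A - i)ψ` to `(A + i)ψ`. Both have squared norm `‖Aψ‖² + ‖ψ‖²`, and `A + i` is onto.
-/
lemma isCayley_resolventOp [CompleteSpace E] (hA : IsSelfAdjoint A) : IsCayley (resolventOp A Complex.I) := by
  have hs := isFormalAdjoint_self hA
  have hR := isResolvent_resolventOp hA
  set R := resolventOp A Complex.I
  set U := 1 + (2 * Complex.I) • R with hU
  have hUA : ∀ ψ : A.domain, U (A ψ - Complex.I • (ψ : E)) = A ψ + Complex.I • (ψ : E) :=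
    fun ψ => by
      rw [hU, add_apply, smul_apply, hR.2 ψ, one_apply_eq_self]
      module
  have hnorm : ∀ x, ‖U x‖ = ‖x‖ := fun x => by
    obtain ⟨h1, h2⟩ := hR.1 x
    have h3 := norm_sq_sub_smul hs 1 ⟨R x, h1⟩
    have h4 := norm_sq_sub_smul hs (-1) ⟨R x, h1⟩
    have h5 := hUA ⟨R x, h1⟩
    simp only [Complex.ofReal_one, one_mul, Complex.ofReal_neg, neg_mul, neg_smul,
      sub_neg_eq_add] at h3 h4
    rw [h2] at h5 h3
    rw [← h5] at h4
    rw [← sq_eq_sq₀ (norm_nonneg _) (norm_nonneg _), h3, h4]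
    norm_num
  have hsurj : Function.Surjective U := fun y => by
    obtain ⟨R', hR'⟩ := exists_isResolvent hA (lam := -1) (by norm_num)
    obtain ⟨h1, h2⟩ := hR'.1 y
    simp only [Complex.ofReal_one, one_mul, Complex.ofReal_neg, neg_mul, neg_smul,
      sub_neg_eq_add] at h2
    exact ⟨_, (hUA ⟨_, h1⟩).trans h2⟩
  have h1 : star U * U = 1 := (ContinuousLinearMap.norm_map_iff_adjoint_comp_self U).1 hnorm
  refine Unitary.mem_iff.2 ⟨h1, ?_⟩
  ext y
  obtain ⟨x, rfl⟩ := hsurj y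
  have h2 : (star U) (U x) = x := congrArg (fun T : E →L[ℂ] E => T x) h1
  rw [mul_apply_eq_comp, h2, one_apply_eq_self]

lemma denseRange_resolventOp [CompleteSpace E] (hA : IsSelfAdjoint A) : DenseRange (resolventOp A Complex.I) :=
  hA.dense_domain.mono fun ψ hψ => ⟨_, (isResolvent_resolventOp hA).2 ⟨ψ, hψ⟩⟩

/-- The bounded operator `V (A - z)⁻¹`. -/
lemma exists_comp_resolvent {z : ℂ} {R : E →L[ℂ] E} (hR : IsResolvent A z R) {M : ℝ} (hM0 : 0 ≤ M)
    (hM : ∀ ψ : A.domain, ∃ hψ : (ψ : E) ∈ V.domain, ‖V ⟨ψ, hψ⟩‖ ≤ M * ‖A ψ - z • (ψ : E)‖) :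
    ∃ K : E →L[ℂ] E, ‖K‖ ≤ M ∧ ∀ x, ∃ hx : R x ∈ V.domain, K x = V ⟨R x, hx⟩ := by
  have hdom : ∀ x, R x ∈ V.domain := fun x => by
    obtain ⟨h1, _⟩ := hR.1 x
    exact (hM ⟨R x, h1⟩).1
  let K₀ : E →ₗ[ℂ] E := V.toFun.comp ((R : E →ₗ[ℂ] E).codRestrict V.domain hdom)
  have hK : ∀ x, K₀ x = V ⟨R x, hdom x⟩ := fun x => rfl
  refine ⟨K₀.mkContinuous M fun x => ?_, K₀.mkContinuous_norm_le hM0 _, fun x => ⟨hdom x, hK x⟩⟩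
  obtain ⟨h1, h2⟩ := hR.1 x
  obtain ⟨h3, h4⟩ := hM ⟨R x, h1⟩
  rw [h2] at h4
  exact h4

/-! ### The perturbed operators -/

lemma mem_pert_domain {t : ℝ} {ψ : E} :
    ψ ∈ (pert A V t).domain ↔ ψ ∈ A.domain ∧ ψ ∈ V.domain := Iff.rfl

lemma pert_apply (t : ℝ) (ψ : (pert A V t).domain) :
    pert A V t ψ = A ⟨ψ, ψ.2.1⟩ + (t : ℂ) • V ⟨ψ, ψ.2.2⟩ := rfl

lemma pert_pert (t s : ℝ) : pert (pert A V t) V s = pert A V (t + s) := by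
  refine LinearPMap.ext (Submodule.ext fun ψ => ?_) fun ψ h1 h2 => ?_
  · simp only [mem_pert_domain]
    tauto
  · rw [pert_apply, pert_apply, pert_apply]
    push_cast
    rw [add_smul, add_assoc]

lemma pert_one : pert A V 1 = A + V := by
  rw [pert, Complex.ofReal_one, one_smul]

lemma pert_isFormalAdjoint (hA : A.IsFormalAdjoint A) (hV : V.IsFormalAdjoint V) (t : ℝ) :
    (pert A V t).IsFormalAdjoint (pert A V t) := fun x y => by
  rw [pert_apply, pert_apply, inner_add_left, inner_add_right, inner_smul_left, inner_smul_right,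
    Complex.conj_ofReal]
  have h1 := hA ⟨x, x.2.1⟩ ⟨y, y.2.1⟩
  have h2 := hV ⟨x, x.2.2⟩ ⟨y, y.2.2⟩
  dsimp only at h1 h2
  rw [h1, h2]

lemma RelBoundedWith.norm_le {a b : ℝ} (h : RelBoundedWith A V a b) (hA : A.IsFormalAdjoint A)
    {lam : ℝ} (hl : lam ≠ 0) (ψ : A.domain) : ∃ hψ : (ψ : E) ∈ V.domain,
    ‖V ⟨ψ, hψ⟩‖ ≤ (a + b / |lam|) * ‖A ψ - ((lam : ℂ) * Complex.I) • (ψ : E)‖ := by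
  obtain ⟨ha, hb, h⟩ := h
  obtain ⟨hψ, h1⟩ := h ψ
  refine ⟨hψ, h1.trans ?_⟩
  rw [add_mul]
  refine add_le_add (mul_le_mul_of_nonneg_left (norm_le_norm_sub_smul hA lam ψ) ha) ?_
  rw [div_mul_eq_mul_div, mul_div_assoc]
  refine mul_le_mul_of_nonneg_left ?_ hb
  rw [le_div_iff₀ (abs_pos.2 hl), mul_comm]
  exact abs_mul_norm_le_norm_sub_smul hA lam ψ

/-- `A + tV - iλ = (1 + tK)(A - iλ)` with `K = V (A - iλ)⁻¹`, and `‖tK‖ < 1` makes the first factor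
invertible by a Neumann series. -/
lemma exists_pert_sub_smul_eq [CompleteSpace E] (hA : IsSelfAdjoint A) {a b : ℝ} (h : RelBoundedWith A V a b)
    {t lam : ℝ} (hl : lam ≠ 0) (ht : |t| * (a + b / |lam|) < 1) (y : E) :
    ∃ ψ : (pert A V t).domain, pert A V t ψ - ((lam : ℂ) * Complex.I) • (ψ : E) = y := by
  have hs := isFormalAdjoint_self hA
  obtain ⟨R, hR⟩ := exists_isResolvent hA hl
  have h0 : 0 ≤ a + b / |lam| := add_nonneg h.1 (div_nonneg h.2.1 (abs_nonneg _))
  obtain ⟨K, hK, hKV⟩ := exists_comp_resolvent hR h0 (h.norm_le hs hl)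
  have hn : ‖-((t : ℂ) • K)‖ < 1 := by
    rw [norm_neg, norm_smul, Complex.norm_real, Real.norm_eq_abs]
    exact (mul_le_mul_of_nonneg_left hK (abs_nonneg _)).trans_lt ht
  have hu : (1 - -((t : ℂ) • K)) * ↑(Units.oneSub _ hn)⁻¹ = 1 :=
    (Units.oneSub (-((t : ℂ) • K)) hn).mul_inv
  set x := (↑(Units.oneSub _ hn)⁻¹ : E →L[ℂ] E) y with hx
  have hxy : x + (t : ℂ) • K x = y := by
    have := congrArg (fun T : E →L[ℂ] E => T y) hu
    rw [sub_neg_eq_add] at this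
    exact this
  obtain ⟨h1, h2⟩ := hR.1 x
  obtain ⟨h3, h4⟩ := hKV x
  refine ⟨⟨R x, h1, h3⟩, ?_⟩
  have h5 : A ⟨R x, h1⟩ - ((lam : ℂ) * Complex.I) • R x + (t : ℂ) • V ⟨R x, h3⟩ = y := by
    rw [h2, ← h4, hxy]
  rw [pert_apply, ← h5]
  abel

/-- The Kato–Rellich theorem. -/
theorem isSelfAdjoint_pert_of_relBoundedWith [CompleteSpace E] (hA : IsSelfAdjoint A) (hV : V.IsFormalAdjoint V)
    {a b : ℝ} (h : RelBoundedWith A V a b) {t : ℝ} (ht : |t| * a < 1) :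
    IsSelfAdjoint (pert A V t) := by
  have hs := isFormalAdjoint_self hA
  -- For large `lam` the constant `b` no longer counts.
  obtain ⟨lam, hl, hlt⟩ : ∃ lam : ℝ, 0 < lam ∧ |t| * (a + b / lam) < 1 := by
    have h1 : Tendsto (fun lam : ℝ => |t| * (a + b / lam)) atTop (𝓝 (|t| * (a + 0))) :=
      (tendsto_const_nhds.add (tendsto_const_nhds.div_atTop tendsto_id)).const_mul _
    rw [add_zero] at h1
    exact ((eventually_gt_atTop 0).and (h1.eventually_lt_const ht)).exists
  refine isSelfAdjoint_of_surjective (pert_isFormalAdjoint hs hV t) ?_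
    (z := (lam : ℂ) * Complex.I)
    (exists_pert_sub_smul_eq hA h hl.ne' (by rwa [abs_of_pos hl])) ?_
  · exact hA.dense_domain.mono fun ψ hψ => ⟨hψ, (h.2.2 ⟨ψ, hψ⟩).1⟩
  · have := exists_pert_sub_smul_eq hA h (t := t) (neg_ne_zero.2 hl.ne')
      (by rwa [abs_neg, abs_of_pos hl])
    simpa using this

lemma relBound_nonneg (H V : E →ₗ.[ℂ] E) : 0 ≤ relBound H V :=
  Real.sInf_nonneg fun _ h => h.choose_spec.1

theorem isSelfAdjoint_pert [CompleteSpace E] (hH : IsSelfAdjoint H) (hV : V.IsFormalAdjoint V)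
    (hHV : RelBounded H V) {t : ℝ} (ht : |t| * relBound H V < 1) : IsSelfAdjoint (pert H V t) := by
  obtain ⟨a, b, hab⟩ := hHV
  rcases eq_or_ne t 0 with rfl | h0
  · exact isSelfAdjoint_pert_of_relBoundedWith hH hV hab (by simp)
  · have hpos : 0 < |t| := abs_pos.2 h0
    have h1 : relBound H V < 1 / |t| := by rwa [lt_div_iff₀ hpos, mul_comm]
    obtain ⟨a', ⟨b', h2⟩, h3⟩ := exists_lt_of_csInf_lt
      (s := {a | ∃ b, RelBoundedWith H V a b}) ⟨a, b, hab⟩ h1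
    refine isSelfAdjoint_pert_of_relBoundedWith hH hV h2 ?_
    rwa [lt_div_iff₀ hpos, mul_comm] at h3

/-- The Taylor expansion of `s ↦ f(A + sV)` with a bound of the remainder. -/
theorem exists_taylor_pert [CompleteSpace E] (hA : IsSelfAdjoint A) (hV : V.IsFormalAdjoint V) {M : ℝ} (hM0 : 0 ≤ M)
    (hM : ∀ ψ : A.domain, ∃ hψ : (ψ : E) ∈ V.domain,
      ‖V ⟨ψ, hψ⟩‖ ≤ M * ‖A ψ - Complex.I • (ψ : E)‖)
    {f : ℝ → ℂ} (hf : ContDiff ℝ ∞ f)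
    (hf0 : IsC₀ f) (μ : ℕ → ComplexMeasure ℝ) (hμ : ∀ n, IsFourierOf (weightedDeriv f n) (μ n))
    {b : ℕ → ℝ} (hb : ∀ p, (μ p).variation.real Set.univ / p.factorial ≤ b p) :
    ∃ a : ℕ → E →L[ℂ] E, (∀ n, ‖a n‖ ≤ M ^ n * beta b n 0) ∧
      ∀ s, IsSelfAdjoint (pert A V s) → ∀ n,
        ‖funcCalc f (pert A V s) - ∑ k ∈ Finset.range n, s ^ k • a k‖
          ≤ |s| ^ n * (M ^ n * beta b n 0) := by
  have hb0 : ∀ p, 0 ≤ b p := fun p => le_trans (by positivity) (hb p)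
  have hR := isResolvent_resolventOp hA
  obtain ⟨K, hK, hKV⟩ := exists_comp_resolvent hR hM0 hM
  have hRK : ∀ x y, inner ℂ (K x) (resolventOp A Complex.I y)
      = inner ℂ (resolventOp A Complex.I x) (K y) := fun x y => by
    obtain ⟨h1, h2⟩ := hKV x
    obtain ⟨h3, h4⟩ := hKV y
    rw [h2, h4]
    exact hV ⟨_, h1⟩ ⟨_, h3⟩
  obtain ⟨a, ha1, ha2⟩ := exists_taylor (isCayley_resolventOp hA) (denseRange_resolventOp hA) hRK
    hf hf0 μ hμ hb
  have hle : ∀ n, ‖K‖ ^ n * beta b n 0 ≤ M ^ n * beta b n 0 := fun n =>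
    mul_le_mul_of_nonneg_right (pow_le_pow_left₀ (norm_nonneg _) hK n) (beta_nonneg hb0 _ _)
  refine ⟨a, fun n => (ha1 n).trans (hle n), fun s hs n => ?_⟩
  have hP : IsPerturbed (resolventOp A Complex.I) K s (resolventOp (pert A V s) Complex.I) := by
    refine ⟨isCayley_resolventOp hs, fun ψ => ?_⟩
    obtain ⟨h1, h2⟩ := (isResolvent_resolventOp hs).1 ψ
    set φ := resolventOp (pert A V s) Complex.I ψ
    have h3 := hR.2 ⟨φ, h1.1⟩
    -- With `ψ = (A + sV - i)φ` the vector `ξ = (A - i)φ` has `R ξ = φ` and `K ξ = V φ`.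
    refine ⟨A ⟨φ, h1.1⟩ - Complex.I • φ, h3.symm, ?_⟩
    obtain ⟨h4, h5⟩ := hKV (A ⟨φ, h1.1⟩ - Complex.I • φ)
    have h6 : V ⟨_, h4⟩ = V ⟨φ, h1.2⟩ := by
      congr 1
      exact Subtype.ext h3
    rw [h5, h6, ← h2, pert_apply]
    abel
  have h1 := ha2 s _ hP n
  simp only [← Complex.ofReal_pow, Complex.coe_smul] at h1
  exact h1.trans (mul_le_mul_of_nonneg_left (hle n) (by positivity))

end Unbounded

end RelTaylor
end

noncomputable section

namespace RelTaylor

/-! ### The Taylor series -/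

section Series

variable {E : Type*} [NormedAddCommGroup E] [InnerProductSpace ℂ E]
  {H V : E →ₗ.[ℂ] E}

/-- Relative boundedness ensures that `relOp` is not its default value `0`; it is then evaluated at
`(H - i)ψ`. -/
lemma norm_le_norm_relOp_mul [CompleteSpace E] (hH : IsSelfAdjoint H) (hHV : RelBounded H V) (ψ : H.domain) :
    ∃ hψ : (ψ : E) ∈ V.domain, ‖V ⟨ψ, hψ⟩‖ ≤ ‖relOp H V‖ * ‖H ψ - Complex.I • (ψ : E)‖ := by
  obtain ⟨a, b, hab⟩ := hHV
  have hR := isResolvent_resolventOp hH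
  have hM := fun ψ => hab.norm_le (isFormalAdjoint_self hH) (one_ne_zero (α := ℝ)) ψ
  simp only [abs_one, div_one, Complex.ofReal_one, one_mul] at hM
  obtain ⟨K, -, hK⟩ := exists_comp_resolvent hR (add_nonneg hab.1 hab.2.1) hM
  have hex : ∃ T : E →L[ℂ] E, ∀ x : E, ∃ hx : resolventOp H Complex.I x ∈ V.domain,
      T x = V ⟨resolventOp H Complex.I x, hx⟩ := ⟨K, hK⟩
  have hspec : ∀ x : E, ∃ hx : resolventOp H Complex.I x ∈ V.domain,
      relOp H V x = V ⟨resolventOp H Complex.I x, hx⟩ := by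
    rw [relOp, dif_pos hex]
    exact hex.choose_spec
  obtain ⟨h1, h2⟩ := hspec (H ψ - Complex.I • (ψ : E))
  obtain ⟨h3, -⟩ := hM ψ
  refine ⟨h3, ?_⟩
  have h4 : V ⟨_, h1⟩ = V ⟨ψ, h3⟩ := congrArg _ (Subtype.ext (hR.2 ψ))
  rw [← h4, ← h2]
  exact (relOp H V).le_opNorm _

/-- `‖(H - i)ψ‖ ≤ ‖(H + tV - i)ψ‖ + |t| ‖Vψ‖`, and `k |t| ≤ 1/2` allows the last term to be absorbed
by doubling `k`. This makes the expansions uniform in the base point. -/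
lemma norm_le_of_pert {k t : ℝ} (ht : k * |t| ≤ 1 / 2)
    (h : ∀ ψ : H.domain, ∃ hψ : (ψ : E) ∈ V.domain,
      ‖V ⟨ψ, hψ⟩‖ ≤ k * ‖H ψ - Complex.I • (ψ : E)‖) (hk : 0 ≤ k)
    (ψ : (pert H V t).domain) : ∃ hψ : (ψ : E) ∈ V.domain,
      ‖V ⟨ψ, hψ⟩‖ ≤ 2 * k * ‖pert H V t ψ - Complex.I • (ψ : E)‖ := by
  refine ⟨ψ.2.2, ?_⟩
  obtain ⟨h1, h2⟩ := h ⟨ψ, ψ.2.1⟩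
  have h3 : H ⟨ψ, ψ.2.1⟩ - Complex.I • (ψ : E)
      = (pert H V t ψ - Complex.I • (ψ : E)) - (t : ℂ) • V ⟨ψ, h1⟩ := by
    rw [pert_apply]
    abel
  have h4 : ‖H ⟨ψ, ψ.2.1⟩ - Complex.I • (ψ : E)‖
      ≤ ‖pert H V t ψ - Complex.I • (ψ : E)‖ + |t| * ‖V ⟨ψ, h1⟩‖ := by
    rw [h3]
    refine (norm_sub_le _ _).trans (le_of_eq ?_)
    rw [norm_smul, Complex.norm_real, Real.norm_eq_abs]
  have h5 := mul_le_mul_of_nonneg_left h4 hk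
  have h6 := mul_le_mul_of_nonneg_right ht (norm_nonneg (V ⟨ψ, h1⟩))
  dsimp only at h2
  linarith

/-- Smoothness of `t ↦ f(H + tV)` at `0`, with bounds of the Taylor terms and of the remainder. -/
theorem contDiffAt_funcCalc_pert [CompleteSpace E] (hH : IsSelfAdjoint H) (hV : V.IsFormalAdjoint V)
    (hHV : RelBounded H V) (ha : relBound H V < 1) {f : ℝ → ℂ} (hf : ContDiff ℝ ∞ f)
    (hf0 : IsC₀ f) (μ : ℕ → ComplexMeasure ℝ) (hμ : ∀ n, IsFourierOf (weightedDeriv f n) (μ n))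
    {b : ℕ → ℝ} (hb : ∀ p, (μ p).variation.real Set.univ / p.factorial ≤ b p) :
    ContDiffAt ℝ ∞ (fun t : ℝ => funcCalc f (pert H V t)) 0 ∧
      (∀ n, ‖taylorTerm f H V n‖ ≤ ‖relOp H V‖ ^ n * beta b n 0) ∧
      ∀ n, ‖funcCalc f (H + V) - ∑ k ∈ Finset.range n, taylorTerm f H V k‖
        ≤ ‖relOp H V‖ ^ n * beta b n 0 := by
  have hb0 : ∀ p, 0 ≤ b p := fun p => le_trans (by positivity) (hb p)
  set κ := ‖relOp H V‖ with hκ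
  have hκ0 : 0 ≤ κ := norm_nonneg _
  have hrel := norm_le_norm_relOp_mul hH hHV
  rw [← hκ] at hrel
  have hsa : ∀ t : ℝ, |t| ≤ 1 → IsSelfAdjoint (pert H V t) := fun t ht =>
    isSelfAdjoint_pert hH hV hHV
      ((mul_le_of_le_one_left (relBound_nonneg H V) ht).trans_lt ha)
  obtain ⟨a₀, ha₀, hr₀⟩ := exists_taylor_pert hH hV hκ0 hrel hf hf0 μ hμ hb
  set r : ℝ := 1 / (2 * (κ + 1)) with hr
  have hrpos : 0 < r := by positivity
  have hr1 : r ≤ 1 := by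
    rw [hr, div_le_one (by positivity)]
    linarith
  have hrκ : ∀ t : ℝ, |t| < r → κ * |t| ≤ 1 / 2 := fun t ht => by
    rw [hr, lt_div_iff₀ (by positivity)] at ht
    nlinarith [abs_nonneg t]
  have hex : ∀ t : ℝ, ∃ a : ℕ → E →L[ℂ] E, |t| < r → ∀ s, |t + s| < r → ∀ n,
      ‖funcCalc f (pert H V (t + s)) - ∑ k ∈ Finset.range n, s ^ k • a k‖
        ≤ (2 * κ) ^ n * beta b n 0 * |s| ^ n := fun t => by
    by_cases ht : |t| < r
    · obtain ⟨a, -, h⟩ := exists_taylor_pert (hsa t (ht.le.trans hr1)) hV (mul_nonneg zero_le_two hκ0)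
        (norm_le_of_pert (hrκ t ht) hrel hκ0) hf hf0 μ hμ hb
      refine ⟨a, fun _ s hs n => ?_⟩
      have := h s (by rw [pert_pert]; exact hsa _ (hs.le.trans hr1)) n
      rw [pert_pert] at this
      rwa [mul_comm]
    · exact ⟨0, fun h => absurd h ht⟩
  choose a ha using hex
  -- At `t = 0` the coefficients with the sharp constant `κ` are kept; at other base points `2κ` is
  -- enough.
  let a' : ℕ → ℝ → E →L[ℂ] E := fun k t => if t = 0 then a₀ k else a t k
  have hT := contDiffAt_of_taylor (F := fun t : ℝ => funcCalc f (pert H V t)) (a := a')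
    (M := fun n => (2 * κ) ^ n * beta b n 0) hrpos fun t s ht hts n => by
      by_cases h0 : t = 0
      · subst h0
        simp only [a', if_true, zero_add] at hts ⊢
        refine (hr₀ s (hsa s (hts.le.trans hr1)) n).trans ?_
        rw [mul_comm]
        refine mul_le_mul_of_nonneg_right (mul_le_mul_of_nonneg_right
          (pow_le_pow_left₀ hκ0 (by linarith) n) (beta_nonneg hb0 _ _)) (by positivity)
      · simp only [a', if_neg h0]
        exact ha t ht s hts n
  have hterm : ∀ n, taylorTerm f H V n = a₀ n := fun n => by
    rw [taylorTerm, hT.2 n, smul_smul, inv_mul_cancel₀ (by positivity), one_smul]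
    exact if_pos rfl
  refine ⟨hT.1, fun n => by rw [hterm]; exact ha₀ n, fun n => ?_⟩
  -- The expansion at `0` holds at `s = 1`, outside the interval of radius `r`: it needs only that
  -- `H + V` is self-adjoint.
  have := hr₀ 1 (hsa 1 (by simp)) n
  simpa [hterm, pert_one] using this

/-- A series with geometrically decreasing terms and remainders converges. -/
lemma summable_hasSum_of_le {Y : Type*} [NormedAddCommGroup Y] [CompleteSpace Y] {x : ℕ → Y} {y : Y}
    {c q : ℝ} (hq0 : 0 ≤ q) (hq : q < 1) (h1 : ∀ n, ‖x n‖ ≤ c * q ^ n)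
    (h2 : ∀ n, ‖y - ∑ k ∈ Finset.range n, x k‖ ≤ c * q ^ n) :
    Summable (fun n => ‖x n‖) ∧ HasSum x y := by
  have hs : Summable fun n => ‖x n‖ := Summable.of_nonneg_of_le (fun n => norm_nonneg _) h1
    ((summable_geometric_of_lt_one hq0 hq).mul_left c)
  refine ⟨hs, hs.of_norm.hasSum_iff_tendsto_nat.2 ?_⟩
  rw [tendsto_iff_norm_sub_tendsto_zero]
  refine squeeze_zero (fun n => norm_nonneg _) (fun n => (norm_sub_rev _ _).trans_le (h2 n)) ?_
  simpa using (tendsto_pow_atTop_nhds_zero_of_lt_one hq0 hq).const_mul c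

/-- With `D ^ (1 - γ) = C / ε`, this is `D^p / p! ≤ e^D` raised to the power `1 - γ`. -/
lemma exists_pow_mul_factorial_rpow_le {C γ ε : ℝ} (hC : 0 ≤ C) (hγ : γ < 1) (hε : 0 < ε) :
    ∃ G : ℝ, ∀ p : ℕ, C ^ p * (p.factorial : ℝ) ^ γ / p.factorial ≤ G * ε ^ p := by
  have hγ' : 0 < 1 - γ := by linarith
  set D : ℝ := (C / ε) ^ (1 - γ)⁻¹ with hD
  have hCε : 0 ≤ C / ε := by positivity
  have hD0 : 0 ≤ D := Real.rpow_nonneg hCε _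
  refine ⟨Real.exp D ^ (1 - γ), fun p => ?_⟩
  have hp : (0 : ℝ) < p.factorial := by positivity
  have h1 : D ^ (1 - γ) = C / ε := by
    rw [hD, ← Real.rpow_mul hCε, inv_mul_cancel₀ hγ'.ne', Real.rpow_one]
  have h2 : (D ^ p / p.factorial) ^ (1 - γ) ≤ Real.exp D ^ (1 - γ) :=
    Real.rpow_le_rpow (by positivity) (Real.pow_div_factorial_le_exp D hD0 p) hγ'.le
  have h3 : (D ^ p / p.factorial) ^ (1 - γ)
      = (C / ε) ^ p * ((p.factorial : ℝ) ^ γ / p.factorial) := by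
    rw [Real.div_rpow (by positivity) hp.le, ← Real.rpow_pow_comm hD0, h1, Real.rpow_sub hp,
      Real.rpow_one, div_div_eq_mul_div, mul_div_assoc]
  rw [h3] at h2
  calc C ^ p * (p.factorial : ℝ) ^ γ / p.factorial
      = (C / ε) ^ p * ((p.factorial : ℝ) ^ γ / p.factorial) * ε ^ p := by
        rw [div_pow]
        field_simp
    _ ≤ _ := mul_le_mul_of_nonneg_right h2 (by positivity)

end Series

end RelTaylor
end

/-! ### The theorem -/

theorem mainTheorem2 {E : Type*} [NormedAddCommGroup E] [InnerProductSpace ℂ E] [CompleteSpace E]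
    [TopologicalSpace.SeparableSpace E]
    (H V : E →ₗ.[ℂ] E) (hH : IsSelfAdjoint H) (hV : V.IsFormalAdjoint V)
    (hHV : RelTaylor.RelBounded H V) (ha : RelTaylor.relBound H V < 1)
    (f : ℝ → ℂ) (hf : ∀ n : ℕ, 1 ≤ n → f ∈ RelTaylor.W n)
    (μ : ℕ → ComplexMeasure ℝ)
    (hμ : ∀ n, RelTaylor.IsFourierOf (RelTaylor.weightedDeriv f n) (μ n))
    (c C : ℝ) (hc : 0 ≤ c) (hC : 0 ≤ C) :
    -- the operators `H + tV` are self-adjoint, and all derivatives at `t = 0` exist in norm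
    (∀ t : ℝ, |t| * RelTaylor.relBound H V < 1 → IsSelfAdjoint (RelTaylor.pert H V t)) ∧
    ContDiffAt ℝ ∞ (fun t : ℝ => RelTaylor.funcCalc f (RelTaylor.pert H V t)) 0 ∧
    -- absolutely norm-convergent Taylor expansion
    ((∀ n : ℕ, 1 ≤ n →
        (μ n).variation Set.univ ≤ ENNReal.ofReal (c * C ^ n * n.factorial)) →
      (1 + C) * ‖RelTaylor.relOp H V‖ < 1 →
      Summable (fun n => ‖RelTaylor.taylorTerm f H V n‖) ∧
      HasSum (RelTaylor.taylorTerm f H V) (RelTaylor.funcCalc f (H + V))) ∧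
    -- bound of the Taylor remainder
    ((∀ n : ℕ, (μ n).variation Set.univ ≤ ENNReal.ofReal (c * C ^ n * n.factorial)) →
      ∀ n : ℕ, ‖RelTaylor.funcCalc f (H + V)
          - ∑ k ∈ Finset.range n, RelTaylor.taylorTerm f H V k‖
        ≤ c * ((1 + C) * ‖RelTaylor.relOp H V‖) ^ n) ∧
    -- slower growth: no smallness in terms of `C`
    (∀ γ : ℝ, γ < 1 →
      (∀ n : ℕ, 1 ≤ n →
        (μ n).variation Set.univ ≤ ENNReal.ofReal (c * C ^ n * (n.factorial : ℝ) ^ γ)) →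
      ‖RelTaylor.relOp H V‖ < 1 →
      Summable (fun n => ‖RelTaylor.taylorTerm f H V n‖) ∧
      HasSum (RelTaylor.taylorTerm f H V) (RelTaylor.funcCalc f (H + V))) := by
  have hfs : ContDiff ℝ ∞ f := contDiff_infty.2 fun n =>
    (hf (n + 1) (by omega)).1.of_le (by exact_mod_cast Nat.le_succ n)
  have hf0 : RelTaylor.IsC₀ f := by
    have h := (hf 1 le_rfl).2 0 (by omega)
    have e : RelTaylor.weightedDeriv f 0 = f := by simp [RelTaylor.weightedDeriv]
    rw [e] at h
    exact ⟨h.1, h.2.1⟩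
  set κ := ‖RelTaylor.relOp H V‖ with hκ
  have hκ0 : 0 ≤ κ := norm_nonneg _
  let b : ℕ → ℝ := fun p => (μ p).variation.real Set.univ / p.factorial
  obtain ⟨hsmooth, hterm, hrem⟩ := RelTaylor.contDiffAt_funcCalc_pert hH hV hHV ha hfs hf0 μ hμ
    (b := b) fun p => le_rfl
  have hbound : ∀ {p : ℕ} {x : ℝ}, 0 ≤ x → (μ p).variation Set.univ ≤ ENNReal.ofReal x →
      b p ≤ x / p.factorial := fun hx h =>
    div_le_div_of_nonneg_right (ENNReal.toReal_le_of_le_ofReal hx h) (by positivity)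
  have hbeta : ∀ {c' C' : ℝ}, (∀ p, b p ≤ c' * C' ^ p) → ∀ n,
      κ ^ n * RelTaylor.beta b n 0 ≤ c' * ((1 + C') * κ) ^ n := fun {c' C'} h n => by
    refine (mul_le_mul_of_nonneg_left (RelTaylor.beta_le h n 0) (by positivity)).trans
      (le_of_eq ?_)
    rw [mul_pow]
    ring
  have hseries : ∀ {c' C' : ℝ}, 0 ≤ C' → (∀ p, 1 ≤ p → b p ≤ c' * C' ^ p) → (1 + C') * κ < 1 →
      Summable (fun n => ‖RelTaylor.taylorTerm f H V n‖) ∧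
      HasSum (RelTaylor.taylorTerm f H V) (RelTaylor.funcCalc f (H + V)) :=
    fun {c' C'} hC' h hlt => by
      -- The growth bound starts at `p = 1`; enlarging the constant covers `p = 0`.
      have h' : ∀ p, b p ≤ max c' (b 0) * C' ^ p := fun p => by
        rcases Nat.eq_zero_or_pos p with rfl | hp
        · simp
        · exact (h p hp).trans (mul_le_mul_of_nonneg_right (le_max_left _ _) (by positivity))
      exact RelTaylor.summable_hasSum_of_le (by positivity) hlt
        (fun n => (hterm n).trans (hbeta h' n)) (fun n => (hrem n).trans (hbeta h' n))
  refine ⟨fun t ht => RelTaylor.isSelfAdjoint_pert hH hV hHV ht, hsmooth, fun h hlt => ?_,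
    fun h n => ?_, fun γ hγ h hlt => ?_⟩
  · refine hseries (c' := c) hC (fun p hp => (hbound (by positivity) (h p hp)).trans (le_of_eq ?_)) hlt
    field_simp
  · refine (hrem n).trans (hbeta (fun p => (hbound (by positivity) (h p)).trans (le_of_eq ?_)) n)
    field_simp
  -- As `γ < 1`, the bounds decay faster than `ε^p` for every `ε > 0`, so `ε` can replace `C` and
  -- only `κ < 1` matters.
  · obtain ⟨ε, hε, hεlt⟩ : ∃ ε : ℝ, 0 < ε ∧ (1 + ε) * κ < 1 := by
      refine ⟨(1 - κ) / 2, by linarith, ?_⟩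
      nlinarith
    obtain ⟨G, hG⟩ := RelTaylor.exists_pow_mul_factorial_rpow_le hC hγ hε
    refine hseries (c' := c * G) hε.le (fun p hp => (hbound (by positivity) (h p hp)).trans ?_)
      hεlt
    rw [mul_assoc c, mul_assoc c, mul_div_assoc]
    exact mul_le_mul_of_nonneg_left (hG p) hc
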